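/- For a finite graph $G$ (loops and multiple edges allowed) with edge set $E$, put $P_G=\sum_T\prod_{e\notin T}x_e$ and $Q_G=\sum_T\prod_{e\in T}x_e$ in $\mathbb Z[x_e : e\in E]$, where $T$ runs over the spanning trees of $G$, and let $Y_G$ and $X_G$ be the complements in $\mathbb A^E_{\mathbb Z}$ of the hypersurfaces $P_G=0$ and $Q_G=0$. For a finite simple graph $G$ with vertices $v_1,\dots,v_n$, let $Z^o_G$ be the scheme of nondegenerate symmetric $n\times n$ matrices $M$ with $M_{ij}=0$ whenever $i\ne j$ and $v_i,v_j$ are not adjacent. For a scheme $X$ of finite type over $\mathbb Z$, let $[X]$ denote the function $q\mapsto \#X(\mathbb F_q)$ on the set of prime powers. For a matroid $M$ of rank $r$ with ground set $E_M$ and rank function $\rho$, let $[X(M)](q)$ be the number of representations of $M$ over $\mathbb F_q$, i.e. of maps $f:E_M\to\mathbb F_q^{\,r}$ such that $\dim\operatorname{span} f(S)=\rho(S)$ for all $S\subseteq E_M$; $M$ is representable over $\mathbb F_q$ if such a map exists. Then: 1. (Stembridge's conjecture is false.) There is a finite simple graph $G$ for which $[Z^o_G]$ is not a polynomial in $q$.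 2. (Stanley's conjecture is false.) There is a finite graph $G$ for which $[X_G]$ is not a polynomial in $q$. 3. (Kontsevich's conjecture is false.) There is a finite graph $G$ for which $[Y_G]$ is not a polynomial in $q$; in particular $[Y_G]\notin\mathbb Z[q]$. 4. The Fano matroid $F$, i.e. the matroid with ground set $\mathbb P^2(\mathbb F_2)$ given by linear independence over $\mathbb F_2$, has rank $3$; it is representable over $\mathbb F_q$ if and only if $2\mid q$; and $[X(F)]$ is not a rational function of $q$: there are no polynomials $a,b\in\mathbb Q[q]$, $b\neq0$, with $b(q)\,[X(F)](q)=a(q)$ for all prime powers $q$. In 1-3, "polynomial" means a polynomial with rational coefficients, so in particular no polynomial with integer coefficients works either. -/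

import Mathlib

open Polynomial

noncomputable section

namespace PointCount

/-! ### Counting functions on finite fields

The counting function `q ↦ #X(𝔽_q)` of a scheme `X` over `ℤ` is represented by the assignment
`K ↦ #X(K)` on all finite fields `K`; it depends on `q = #K` only. -/

/-- The counting function `N` is a polynomial in `q` with coefficients in `A`
(`A = ℤ` or `A = ℚ`). -/
def IsPolynomial (A : Type) [CommRing A] (N : (K : Type) → [Field K] → ℕ) : Prop :=
  ∃ p : A[X], ∀ (K : Type) [Field K] [Finite K], (N K : A) = p.eval (Nat.card K : A)

/-- Being a polynomial with integer coefficients is the stronger property. -/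
theorem IsPolynomial.int_to_rat {N : (K : Type) → [Field K] → ℕ} (h : IsPolynomial ℤ N) :
    IsPolynomial ℚ N := by
  obtain ⟨p, hp⟩ := h
  refine ⟨p.map (Int.castRingHom ℚ), fun K _ _ => ?_⟩
  have h1 := congrArg (Int.castRingHom ℚ) (hp K)
  have h2 := Polynomial.eval_map_apply (f := Int.castRingHom ℚ) (p := p) (Nat.card K : ℤ)
  simp only [eq_intCast, Int.cast_natCast] at h1 h2
  rw [h2, h1]

/-- The counting function `N` is a rational function `a / b` of `q`. The equation is cleared of
denominators, so nothing is required of `N` at the zeros of `b` except that `a` vanish there. -/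
def IsRational (N : (K : Type) → [Field K] → ℕ) : Prop :=
  ∃ a b : ℚ[X], b ≠ 0 ∧ ∀ (K : Type) [Field K] [Finite K],
    b.eval (Nat.card K : ℚ) * (N K : ℚ) = a.eval (Nat.card K : ℚ)

/-! ### Spanning trees of graphs with loops and multiple edges -/

section Graphs

variable {V E : Type}

/-- The number of connected components. -/
def bettiZero (G : Graph V E) : ℕ :=
  Nat.card (Quot fun x y : G.vertexSet => G.Adj x y)

/-- The first Betti number of a finite graph, from the Euler characteristic
`b₀ - b₁ = #vertices - #edges`. -/
def bettiOne (G : Graph V E) : ℤ :=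
  (bettiZero G : ℤ) - (G.vertexSet.ncard : ℤ) + (G.edgeSet.ncard : ℤ)

/-- A finite graph is a tree if `b₀ = 1` and `b₁ = 0`. -/
def IsTree (G : Graph V E) : Prop :=
  bettiZero G = 1 ∧ bettiOne G = 0

/-- The edge set `T` is that of a spanning tree: the subgraph of `G` with all the vertices of `G`
and the edges in `T` is a tree. -/
def IsSpanningTree (G : Graph V E) (T : Finset G.edgeSet) : Prop :=
  IsTree (G.restrict (Subtype.val '' (T : Set G.edgeSet)))

open Classical in
/-- Kontsevich's polynomial `P_G = ∑_T ∏_{e ∉ T} x_e`, over all spanning trees `T`. -/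
def polyP (G : Graph V E) [Fintype G.edgeSet] : MvPolynomial G.edgeSet ℤ :=
  ∑ T : Finset G.edgeSet with IsSpanningTree G T, ∏ e ∈ Tᶜ, MvPolynomial.X e

open Classical in
/-- Stanley's polynomial `Q_G = ∑_T ∏_{e ∈ T} x_e`, over all spanning trees `T`. -/
def polyQ (G : Graph V E) [Fintype G.edgeSet] : MvPolynomial G.edgeSet ℤ :=
  ∑ T : Finset G.edgeSet with IsSpanningTree G T, ∏ e ∈ T, MvPolynomial.X e

/-- `#Y_G(K)`, where `Y_G` is the complement of the hypersurface `P_G = 0`. -/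
def countY (G : Graph V E) [Fintype G.edgeSet] (K : Type) [Field K] : ℕ :=
  Nat.card {x : G.edgeSet → K // MvPolynomial.aeval x (polyP G) ≠ 0}

/-- `#X_G(K)`, where `X_G` is the complement of the hypersurface `Q_G = 0`. -/
def countX (G : Graph V E) [Fintype G.edgeSet] (K : Type) [Field K] : ℕ :=
  Nat.card {x : G.edgeSet → K // MvPolynomial.aeval x (polyQ G) ≠ 0}

end Graphs

/-- `#Z°_G(K)`: the number of nondegenerate symmetric matrices over `K` whose off-diagonal entries
vanish outside the edges of the simple graph `G`. -/
def countZo {n : ℕ} (G : SimpleGraph (Fin n)) (K : Type) [Field K] : ℕ :=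
  Nat.card {M : Matrix (Fin n) (Fin n) K //
    M.IsSymm ∧ M.det ≠ 0 ∧ ∀ i j, i ≠ j → ¬ G.Adj i j → M i j = 0}

/-! ### The three conjectures

For each of them, the coefficient ring of the polynomials is a parameter; the version for `ℤ`
implies the version for `ℚ`. -/

/-- `[Y_G] ∈ A[q]` for all finite graphs `G`. -/
def KontsevichConjecture (A : Type) [CommRing A] : Prop :=
  ∀ (V E : Type) [Finite V] [Finite E] (G : Graph V E) [Fintype G.edgeSet],
    IsPolynomial A (countY G)

/-- `[X_G] ∈ A[q]` for all finite graphs `G`. -/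
def StanleyConjecture (A : Type) [CommRing A] : Prop :=
  ∀ (V E : Type) [Finite V] [Finite E] (G : Graph V E) [Fintype G.edgeSet],
    IsPolynomial A (countX G)

/-- `[Z°_G] ∈ A[q]` for all finite simple graphs `G`. -/
def StembridgeConjecture (A : Type) [CommRing A] : Prop :=
  ∀ (n : ℕ) (G : SimpleGraph (Fin n)), IsPolynomial A (countZo G)

/-! ### Matroid representations and the Fano matroid -/

section Matroids

variable {α : Type}

/-- The representations of the matroid `M` in `K ^ s`: the maps `f` from the ground set to `K ^ s`
such that `f(X)` spans a space of dimension `ρ(X)`, for all subsets `X` of the ground set. -/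
def Representation (M : Matroid α) (s : ℕ) (K : Type) [Field K] : Type :=
  {f : M.E → (Fin s → K) // ∀ X : Set M.E,
    (Module.finrank K (Submodule.span K (f '' X)) : ℕ∞) = M.eRk (Subtype.val '' X)}

/-- The rank of `M` as a natural number. -/
def rank (M : Matroid α) : ℕ := M.eRank.toNat

/-- `M` has a representation over `K`, in the space of dimension the rank of `M`. -/
def IsRepresentable (M : Matroid α) (K : Type) [Field K] : Prop :=
  Nonempty (Representation M (rank M) K)

/-- `#X(M)(K)`: the number of representations of `M` in `K ^ r`, for `r` the rank of `M`. -/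
def countRepresentations (M : Matroid α) (K : Type) [Field K] : ℕ :=
  Nat.card (Representation M (rank M) K)

/-- The matroid of a finite family of vectors: a set of indices is independent if the vectors with
these indices are linearly independent. -/
def vectorMatroid [Finite α] (F : Type) [Field F] {W : Type} [AddCommGroup W] [Module F W]
    (v : α → W) : Matroid α :=
  (IndepMatroid.ofFinite (E := Set.univ) Set.finite_univ (fun I => LinearIndepOn F v I)
    (linearIndepOn_empty F v) (fun _ _ hJ hIJ => hJ.mono hIJ)
    (by
      intro I J hI hJ hlt
      by_contra! hcon
      have hspan : ∀ e ∈ J, v e ∈ Submodule.span F (v '' I) := by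
        intro e he
        by_cases heI : e ∈ I
        · exact Submodule.subset_span ⟨e, heI, rfl⟩
        · by_contra hv
          exact hcon e he heI (hI.insert hv)
      have hle : Submodule.span F (v '' J) ≤ Submodule.span F (v '' I) := by
        rw [Submodule.span_le]
        rintro _ ⟨e, he, rfl⟩
        exact hspan e he
      have hcard : ∀ S : Set α, LinearIndepOn F v S →
          Module.finrank F (Submodule.span F (v '' S)) = S.ncard := by
        intro S hS
        have := Fintype.ofFinite S
        have h := finrank_span_eq_card (R := F) (b := fun i : S => v i) hS
        rw [Set.image_eq_range, h, ← Nat.card_eq_fintype_card, Nat.card_coe_set_eq]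
      have : Module.Finite F (Submodule.span F (v '' I)) :=
        Module.Finite.span_of_finite F (Set.toFinite _)
      have := Submodule.finrank_mono hle
      rw [hcard J hJ, hcard I hI] at this
      omega)
    (fun _ _ => Set.subset_univ _)).matroid

/-- The Fano matroid: its ground set is the projective plane over the field with two elements, and
each point is represented by a nonzero vector on it. -/
def fanoMatroid : Matroid (Projectivization (ZMod 2) (Fin 3 → ZMod 2)) :=
  vectorMatroid (ZMod 2) Projectivization.rep

end Matroids

end PointCount

end

noncomputable section

/-! ### Regular counting functions -/

namespace PointCount

/-! The three graph conjectures fail together. If all the counts of one conjecture were polynomials,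
then so many other counts would be regular (rational in `q`, with no pole at an integer `q ≥ 2`)
that one of them would vanish at all odd `q` but not at `q = 2`. By `not_isRegular` this is
impossible: the numerator vanishes at all powers of 3, hence identically, and the denominator does
not vanish at 2.

Stembridge: joining `G` with a complete graph on `c` vertices amounts to bordering a matrix `A`
supported on `G` by `c` unconstrained rows and columns. The number of nondegenerate borderings
depends only on the rank of `A` and is zero if the corank exceeds `c`. For varying `c` this is a
triangular system, whose solution gives the number of matrices of each corank
(`isRegular_corankCount`). Subtracting the contributions of proper subgraphs leaves the matrices
whose off-diagonal support is exactly `G` (`isRegular_exactCount`). For the complete tripartite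
graph with parts of size 3 and rank 2, vanishing 3×3 minors force `2 = 0`, whereas over the field
with two elements such a matrix exists.

Stanley: by the matrix tree theorem, `Q` of the join of `G` with a vertex is the determinant of the
generic symmetric matrix supported on `G` (`countZo_eq_card_treeSum`).

Kontsevich: on the torus, inverting the coordinates exchanges the nonvanishing of `P` and `Q`.
Setting a coordinate to zero contracts the edge in `P` and deletes it in `Q`, so inclusion-exclusion
passes from `P` to the torus and from there to `Q`.

Fano matroid: in coordinates, collinearity of the three diagonal points of a complete quadrangle
says `2 = 0`. The count therefore vanishes exactly at odd `q`. -/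

/-- The counting function `N` is a rational function of `q` whose denominator does not vanish at
any integer `≥ 2`. -/
def IsRegular (N : (K : Type) → [Field K] → ℚ) : Prop :=
  ∃ p d : ℚ[X], (∀ n : ℕ, 2 ≤ n → d.eval (n : ℚ) ≠ 0) ∧ ∀ (K : Type) [Field K] [Finite K],
    N K * d.eval (Nat.card K : ℚ) = p.eval (Nat.card K : ℚ)

theorem two_le_card (K : Type) [Field K] [Finite K] : 2 ≤ Nat.card K :=
  Finite.one_lt_card

namespace IsRegular

variable {N N' : (K : Type) → [Field K] → ℚ}

theorem congr (h : IsRegular N) (e : ∀ (K : Type) [Field K] [Finite K], N' K = N K) :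
    IsRegular N' := by
  obtain ⟨p, d, hd, h⟩ := h
  exact ⟨p, d, hd, fun K _ _ => by rw [e, h]⟩

theorem of_poly (p : ℚ[X]) : IsRegular (fun K _ => p.eval (Nat.card K : ℚ)) :=
  ⟨p, 1, by simp, by simp⟩

theorem const (c : ℚ) : IsRegular (fun _ _ => c) :=
  (of_poly (C c)).congr (by simp)

theorem card : IsRegular (fun K _ => (Nat.card K : ℚ)) :=
  (of_poly X).congr (by simp)

theorem add (h : IsRegular N) (h' : IsRegular N') : IsRegular (fun K _ => N K + N' K) := by
  obtain ⟨p, d, hd, h⟩ := h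
  obtain ⟨p', d', hd', h'⟩ := h'
  refine ⟨p * d' + p' * d, d * d', fun n hn => ?_, fun K _ _ => ?_⟩
  · rw [eval_mul]; exact mul_ne_zero (hd n hn) (hd' n hn)
  · simp only [eval_add, eval_mul, ← h, ← h']; ring

theorem mul (h : IsRegular N) (h' : IsRegular N') : IsRegular (fun K _ => N K * N' K) := by
  obtain ⟨p, d, hd, h⟩ := h
  obtain ⟨p', d', hd', h'⟩ := h'
  refine ⟨p * p', d * d', fun n hn => ?_, fun K _ _ => ?_⟩
  · rw [eval_mul]; exact mul_ne_zero (hd n hn) (hd' n hn)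
  · simp only [eval_mul, ← h, ← h']; ring

theorem sub (h : IsRegular N) (h' : IsRegular N') : IsRegular (fun K _ => N K - N' K) :=
  (h.add ((const (-1)).mul h')).congr fun K _ _ => by ring

theorem pow (h : IsRegular N) (n : ℕ) : IsRegular (fun K _ => N K ^ n) := by
  induction n with
  | zero => exact (const 1).congr (by simp)
  | succ n ih => exact (ih.mul h).congr fun K _ _ => pow_succ _ _

theorem sum {ι : Type*} (s : Finset ι) {F : ι → (K : Type) → [Field K] → ℚ}
    (h : ∀ i ∈ s, IsRegular (F i)) : IsRegular (fun K _ => ∑ i ∈ s, F i K) := by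
  classical
  induction s using Finset.induction_on with
  | empty => exact (const 0).congr (by simp)
  | insert a s ha ih =>
    refine ((h a (by simp)).add (ih fun i hi => h i (by simp [hi]))).congr fun K _ _ => ?_
    rw [Finset.sum_insert ha]

/-- Division by a polynomial without zeros at the integers `≥ 2`. -/
theorem of_mul (p : ℚ[X]) (hp : ∀ n : ℕ, 2 ≤ n → p.eval (n : ℚ) ≠ 0)
    (h : IsRegular (fun K _ => N K * p.eval (Nat.card K : ℚ))) : IsRegular N := by
  obtain ⟨a, d, hd, h⟩ := h
  refine ⟨a, p * d, fun n hn => ?_, fun K _ _ => ?_⟩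
  · rw [eval_mul]; exact mul_ne_zero (hp n hn) (hd n hn)
  · rw [eval_mul, ← h]; ring

end IsRegular

theorem IsPolynomial.isRegular {N : (K : Type) → [Field K] → ℕ} (h : IsPolynomial ℚ N) :
    IsRegular (fun K _ => (N K : ℚ)) := by
  obtain ⟨p, hp⟩ := h
  exact (IsRegular.of_poly p).congr fun K _ _ => hp K

/-- A polynomial that vanishes at all powers of a prime is zero. -/
theorem eq_zero_of_eval_prime_pow {a : ℚ[X]} (p : ℕ) (hp : p.Prime)
    (h : ∀ n : ℕ, n ≠ 0 → a.eval ((p ^ n : ℕ) : ℚ) = 0) : a = 0 := by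
  refine Polynomial.eq_zero_of_infinite_isRoot a (Set.Infinite.mono (s := Set.range fun n : ℕ =>
    ((p ^ (n + 1) : ℕ) : ℚ)) ?_ ?_)
  · rintro _ ⟨n, rfl⟩
    exact h (n + 1) (by simp)
  · refine Set.infinite_range_of_injective fun m n hmn => ?_
    have := Nat.pow_right_injective hp.two_le (Nat.cast_injective hmn)
    omega

/-- If a counting function vanishes on all fields of odd order, but not on the field with two
elements, then it is not regular. -/
theorem not_isRegular {N : (K : Type) → [Field K] → ℚ}
    (h3 : ∀ (K : Type) [Field K] [Finite K], (2 : K) ≠ 0 → N K = 0)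
    (h2 : N (ZMod 2) ≠ 0) : ¬ IsRegular N := by
  rintro ⟨p, d, hd, h⟩
  -- The orders `3 ^ n` alone annihilate the numerator.
  have hp : p = 0 := by
    refine eq_zero_of_eval_prime_pow 3 Nat.prime_three fun n hn => ?_
    have : Fact (Nat.Prime 3) := ⟨Nat.prime_three⟩
    have hc : Nat.card (GaloisField 3 n) = 3 ^ n := GaloisField.card 3 n hn
    have : Finite (GaloisField 3 n) := Nat.finite_of_card_ne_zero (by rw [hc]; positivity)
    rw [← hc, ← h, h3, zero_mul]
    intro h2
    have h3 : ((3 : ℕ) : GaloisField 3 n) = 0 := CharP.cast_eq_zero _ 3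
    have : (1 : GaloisField 3 n) = ((3 : ℕ) : GaloisField 3 n) - 2 := by push_cast; ring
    rw [h3, h2, sub_zero] at this
    exact one_ne_zero this
  have := h (ZMod 2)
  rw [hp, eval_zero] at this
  exact (mul_ne_zero h2 (hd _ (two_le_card _))) this

open Matrix

/-! ### Nondegenerate borderings of a symmetric matrix -/

section Border

variable {K : Type} [Field K]
variable {ι κ α β : Type} [Fintype ι] [DecidableEq ι] [Fintype κ] [DecidableEq κ]
  [Fintype α] [DecidableEq α] [Fintype β] [DecidableEq β]

/-- The number of ways to border the symmetric matrix `A` by rows and columns with indices in `κ`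
so that the result is symmetric and nondegenerate. -/
def borderCount (A : Matrix ι ι K) (κ : Type) [Fintype κ] [DecidableEq κ] : ℕ :=
  Nat.card {p : Matrix ι κ K × Matrix κ κ K //
    p.2.IsSymm ∧ (fromBlocks A p.1 p.1ᵀ p.2).det ≠ 0}

/-- Congruence by `Q ⊕ 1` multiplies the bordered determinant by `det Q ^ 2` and acts on the border
by the bijection `C ↦ Qᵀ C`. -/
theorem borderCount_congruence (A Q : Matrix ι ι K) (hQ : Q.det ≠ 0) :
    borderCount (Qᵀ * A * Q) κ = borderCount A κ := by
  have hut : IsUnit Qᵀ.det := by rwa [det_transpose, isUnit_iff_ne_zero]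
  let f : Matrix ι κ K ≃ Matrix ι κ K :=
    { toFun := fun C => Qᵀ * C
      invFun := fun C => Qᵀ⁻¹ * C
      left_inv := fun C => by simp [← Matrix.mul_assoc, Matrix.nonsing_inv_mul _ hut]
      right_inv := fun C => by simp [← Matrix.mul_assoc, Matrix.mul_nonsing_inv _ hut] }
  symm
  refine Nat.card_congr (Equiv.subtypeEquiv (f.prodCongr (Equiv.refl _)) ?_)
  rintro ⟨C, E⟩
  have h : fromBlocks (Qᵀ * A * Q) (Qᵀ * C) (Qᵀ * C)ᵀ E =
      fromBlocks Qᵀ 0 0 1 * fromBlocks A C Cᵀ E * fromBlocks Q 0 0 1 := by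
    simp [fromBlocks_multiply]
  have hdet : (fromBlocks (Qᵀ * A * Q) (Qᵀ * C) (Qᵀ * C)ᵀ E).det =
      Q.det * (fromBlocks A C Cᵀ E).det * Q.det := by
    rw [h, det_mul, det_mul, det_fromBlocks_zero₂₁, det_fromBlocks_zero₂₁, det_one, mul_one,
      mul_one, det_transpose]
  change _ ↔ E.IsSymm ∧ (fromBlocks (Qᵀ * A * Q) (Qᵀ * C) (Qᵀ * C)ᵀ E).det ≠ 0
  rw [hdet]
  simp [hQ]

theorem borderCount_submatrix (A : Matrix ι ι K) (e : α ≃ ι) :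
    borderCount (A.submatrix e e) κ = borderCount A κ := by
  symm
  refine Nat.card_congr (Equiv.subtypeEquiv
    ((Matrix.reindex e.symm (Equiv.refl κ)).prodCongr (Equiv.refl _)) ?_)
  rintro ⟨C, E⟩
  have h : fromBlocks (A.submatrix e e) (C.submatrix e id) (C.submatrix e id)ᵀ E =
      (fromBlocks A C Cᵀ E).submatrix (e.sumCongr (Equiv.refl κ)) (e.sumCongr (Equiv.refl κ)) := by
    ext (i | i) (j | j) <;> simp
  simp only [Equiv.prodCongr_apply, Prod.map, reindex_apply, Equiv.symm_symm, Equiv.coe_refl,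
    Equiv.refl_symm, id]
  rw [h, det_submatrix_equiv_self]

/-- Taking the Schur complement of `A` leaves a bordering of the zero block, with `E` shifted by
`C₁ᵀ A⁻¹ C₁`. The rows `C₁` next to `A` remain free, which gives the power of `q`. -/
theorem borderCount_fromBlocks_zero [Finite K] (A : Matrix α α K) (hs : A.IsSymm)
    (hA : A.det ≠ 0) :
    borderCount (fromBlocks A 0 0 (0 : Matrix β β K)) κ =
      Nat.card K ^ (Fintype.card α * Fintype.card κ) * borderCount (0 : Matrix β β K) κ := by
  have hinv : A⁻¹ᵀ = A⁻¹ := by rw [transpose_nonsing_inv, hs]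
  have hcard : Nat.card (Matrix α κ K) = Nat.card K ^ (Fintype.card α * Fintype.card κ) := by
    rw [Nat.card_congr (Matrix.of.symm : Matrix α κ K ≃ (α → κ → K)), Nat.card_fun, Nat.card_fun,
      Nat.card_eq_fintype_card (α := α), Nat.card_eq_fintype_card (α := κ), ← pow_mul, mul_comm]
  rw [← hcard, borderCount, borderCount, ← Nat.card_prod]
  have key : ∀ (C₁ : Matrix α κ K) (C₂ : Matrix β κ K) (E : Matrix κ κ K),
      (fromBlocks (fromBlocks A 0 0 (0 : Matrix β β K)) (fromRows C₁ C₂) (fromRows C₁ C₂)ᵀ E).det =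
        A.det * (fromBlocks 0 C₂ C₂ᵀ (E - C₁ᵀ * A⁻¹ * C₁)).det := by
    intro C₁ C₂ E
    have h : fromBlocks (fromBlocks A 0 0 (0 : Matrix β β K)) (fromRows C₁ C₂) (fromRows C₁ C₂)ᵀ E =
        (fromBlocks A (fromCols 0 C₁) (fromRows 0 C₁ᵀ) (fromBlocks 0 C₂ C₂ᵀ E)).submatrix
          (Equiv.sumAssoc α β κ) (Equiv.sumAssoc α β κ) := by
      ext ((i | i) | i) ((j | j) | j) <;> simp
    have := A.invertibleOfIsUnitDet (isUnit_iff_ne_zero.2 hA)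
    rw [h, det_submatrix_equiv_self, det_fromBlocks₁₁, invOf_eq_nonsing_inv]
    congr 2
    rw [fromRows_mul, fromRows_mul_fromCols]
    ext (i | i) (j | j) <;> simp
  have hsym : ∀ C₁ : Matrix α κ K, (C₁ᵀ * A⁻¹ * C₁).IsSymm := by
    intro C₁
    rw [IsSymm, transpose_mul, transpose_mul, hinv, transpose_transpose, Matrix.mul_assoc]
  refine Nat.card_congr
    { toFun := fun p => (p.1.1.toRows₁, ⟨(p.1.1.toRows₂,
        p.1.2 - p.1.1.toRows₁ᵀ * A⁻¹ * p.1.1.toRows₁), ?_⟩)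
      invFun := fun p => ⟨(fromRows p.1 p.2.1.1, p.2.1.2 + p.1ᵀ * A⁻¹ * p.1), ?_⟩
      left_inv := fun p => ?_
      right_inv := fun p => ?_ }
  · obtain ⟨⟨C, E⟩, hE, hd⟩ := p
    refine ⟨hE.sub (hsym _), fun h0 => hd ?_⟩
    have := key C.toRows₁ C.toRows₂ E
    rw [fromRows_toRows] at this
    rw [this, h0, mul_zero]
  · obtain ⟨C₁, ⟨C₂, E⟩, hE, hd⟩ := p
    refine ⟨hE.add (hsym _), ?_⟩
    rw [key, add_sub_cancel_right]
    exact mul_ne_zero hA hd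
  · ext <;> simp
  · ext <;> simp

/-- Every symmetric matrix is congruent to the sum of a nondegenerate one and zero. -/
theorem exists_congruence (A : Matrix ι ι K) (hs : A.IsSymm) :
    ∃ (Q : Matrix ι ι K) (e : ι ≃ Fin A.rank ⊕ Fin (Fintype.card ι - A.rank))
      (A' : Matrix (Fin A.rank) (Fin A.rank) K),
      Q.det ≠ 0 ∧ A'.IsSymm ∧ A'.det ≠ 0 ∧
      Qᵀ * A * Q = (fromBlocks A' 0 0 0).submatrix e e := by
  -- The form is nondegenerate on any complement of its kernel. Nothing is diagonalized, so
  -- characteristic two is no exception.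
  obtain ⟨W, hW⟩ := (LinearMap.ker A.mulVecLin).exists_isCompl
  have hsum := Submodule.finrank_add_eq_of_isCompl hW
  have hrk := A.mulVecLin.finrank_range_add_finrank_ker
  rw [Module.finrank_fintype_fun_eq_card] at hsum hrk
  change A.rank + _ = _ at hrk
  have hWr : Module.finrank K W = A.rank := by omega
  have hkr : Module.finrank K (LinearMap.ker A.mulVecLin) = Fintype.card ι - A.rank := by omega
  let b := ((Module.finBasisOfFinrankEq K W hWr).prod (Module.finBasisOfFinrankEq K _ hkr)).map
    (Submodule.prodEquivOfIsCompl W _ hW.symm)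
  have hbr : ∀ j, A *ᵥ b (Sum.inr j) = 0 := by
    intro j
    have : b (Sum.inr j) ∈ LinearMap.ker A.mulVecLin := by simp [b]
    simpa using this
  have hbl : ∀ i, b (Sum.inl i) ∈ W := by
    intro i
    simp [b]
  let e := (Pi.basisFun K ι).indexEquiv b
  let Q := (Pi.basisFun K ι).toMatrix (b.reindex e.symm)
  have hQ : ∀ i j, Q i j = b (e j) i := by
    intro i j
    simp [Q, Module.Basis.toMatrix_apply]
  have hQd : Q.det ≠ 0 := by
    have := (Pi.basisFun K ι).invertibleToMatrix (b.reindex e.symm)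
    exact (isUnit_det_of_invertible Q).ne_zero
  let D : Matrix _ _ K := (Qᵀ * A * Q).submatrix e.symm e.symm
  have hD : ∀ x y, D x y = b x ⬝ᵥ A *ᵥ b y := by
    intro x y
    simp only [D, submatrix_apply, Matrix.mul_assoc]
    rw [Matrix.mul_apply]
    simp only [dotProduct, transpose_apply, hQ, Equiv.apply_symm_apply]
    refine Finset.sum_congr rfl fun i _ => ?_
    simp [Matrix.mul_apply, mulVec, dotProduct, hQ]
  have hDs : D.IsSymm := by
    ext x y
    rw [transpose_apply, hD, hD, dotProduct_mulVec, ← mulVec_transpose, hs, dotProduct_comm]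
  have hD0 : ∀ x j, D x (Sum.inr j) = 0 := fun x j => by rw [hD, hbr, dotProduct_zero]
  have hDb : D = fromBlocks D.toBlocks₁₁ 0 0 0 := by
    ext (i | i) (j | j)
    · rfl
    · simp [hD0]
    · rw [← hDs.apply, hD0]; simp
    · simp [hD0]
  refine ⟨Q, e, D.toBlocks₁₁, hQd, ?_, ?_, ?_⟩
  · ext i j
    exact hDs.apply _ _
  -- A kernel vector of the block yields `w ∈ W` orthogonal to the whole basis, so `w` lies in `ker
  -- A ∩ W = 0`.
  · intro h0
    obtain ⟨v, hv, hv0⟩ := exists_mulVec_eq_zero_iff.2 h0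
    let w := ∑ i, v i • b (Sum.inl i)
    have hwW : w ∈ W := Submodule.sum_mem _ fun i _ => Submodule.smul_mem _ _ (hbl i)
    have hbw : ∀ x, b x ⬝ᵥ A *ᵥ w = 0 := by
      intro x
      have : b x ⬝ᵥ A *ᵥ w = ∑ i, D x (Sum.inl i) * v i := by
        simp only [w, mulVec_sum, dotProduct_sum, mulVec_smul, dotProduct_smul, hD, smul_eq_mul]
        exact Finset.sum_congr rfl fun i _ => mul_comm _ _
      rw [this]
      rcases x with x | x
      · exact congrFun hv0 x
      · refine Finset.sum_eq_zero fun i _ => ?_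
        rw [← hDs.apply, hD0, zero_mul]
    have hAw : A *ᵥ w = 0 := by
      have hlin : ∀ u : ι → K, u ⬝ᵥ A *ᵥ w = 0 := by
        intro u
        rw [← b.sum_repr u, sum_dotProduct]
        exact Finset.sum_eq_zero fun x _ => by rw [smul_dotProduct, hbw, smul_zero]
      exact dotProduct_eq_zero _ fun u => by rw [dotProduct_comm]; exact hlin u
    have hw0 : w = 0 := by
      have : w ∈ LinearMap.ker A.mulVecLin ⊓ W := ⟨by simpa using hAw, hwW⟩
      rwa [hW.inf_eq_bot, Submodule.mem_bot] at this
    refine hv (funext fun i => ?_)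
    have hli : LinearIndependent K (fun i => b (Sum.inl i)) :=
      b.linearIndependent.comp _ Sum.inl_injective
    exact Fintype.linearIndependent_iff.1 hli v hw0 i
  · rw [← hDb]
    ext i j
    simp [D]

/-- The number of nondegenerate symmetric matrices of size `k + c` that begin with a zero block of
size `k`. -/
def zeroBlockCount (k c : ℕ) (K : Type) [Field K] : ℕ :=
  borderCount (0 : Matrix (Fin k) (Fin k) K) (Fin c)

/-- Only the rank of `A` enters: this is how counts of nondegenerate matrices detect corank. -/
theorem borderCount_eq [Finite K] (A : Matrix ι ι K) (hs : A.IsSymm) (c : ℕ) :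
    borderCount A (Fin c) =
      Nat.card K ^ (A.rank * c) * zeroBlockCount (Fintype.card ι - A.rank) c K := by
  obtain ⟨Q, e, A', hQ, hA's, hA', h⟩ := exists_congruence A hs
  rw [← borderCount_congruence A Q hQ, h, borderCount_submatrix,
    borderCount_fromBlocks_zero A' hA's hA']
  simp [zeroBlockCount]

theorem injective_of_det_fromBlocks_ne_zero {C : Matrix α κ K} {E : Matrix κ κ K}
    (h : (fromBlocks (0 : Matrix α α K) C Cᵀ E).det ≠ 0) (x : α → K) (hx : Cᵀ *ᵥ x = 0) :
    x = 0 := by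
  by_contra hx0
  refine h (exists_mulVec_eq_zero_iff.1 ⟨Sum.elim x 0, fun h0 => hx0 ?_, ?_⟩)
  · ext i
    exact congrFun h0 (Sum.inl i)
  · have h0 : (Sum.elim x 0 : α ⊕ κ → K) ∘ Sum.inr = 0 := rfl
    rw [fromBlocks_mulVec, h0, Sum.elim_comp_inl, hx]
    ext (i | i) <;> simp

theorem zeroBlockCount_of_lt {k c : ℕ} (h : c < k) : zeroBlockCount k c K = 0 := by
  refine @Nat.card_of_isEmpty _ ⟨fun ⟨⟨C, E⟩, _, hd⟩ => ?_⟩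
  have hlt : Module.finrank K (Fin c → K) < Module.finrank K (Fin k → K) := by simpa using h
  refine LinearMap.ker_ne_bot_of_finrank_lt (f := Cᵀ.mulVecLin) hlt ?_
  rw [LinearMap.ker_eq_bot']
  exact fun x hx => injective_of_det_fromBlocks_ne_zero hd x hx

theorem card_isSymm {K : Type} [Finite K] (c : ℕ) :
    Nat.card {E : Matrix (Fin c) (Fin c) K // E.IsSymm} = Nat.card K ^ Nat.card (Sym2 (Fin c)) := by
  rw [← Nat.card_fun]
  exact Nat.card_congr
    { toFun := fun E => Sym2.lift ⟨fun i j => E.1 i j, fun i j => E.2.apply j i⟩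
      invFun := fun f => ⟨Matrix.of fun i j => f s(i, j), by
        ext i j; simp [Sym2.eq_swap]⟩
      left_inv := fun E => by ext; simp
      right_inv := fun f => by ext x; induction x with | _ i j => simp }

/-- With square blocks, nondegeneracy means that `C` is invertible, and `E` is any symmetric matrix.
The value is positive, so it can serve as a divisor. -/
theorem zeroBlockCount_self [Finite K] (c : ℕ) : zeroBlockCount c c K =
    (∏ i : Fin c, (Nat.card K ^ c - Nat.card K ^ (i : ℕ))) *
      Nat.card K ^ Nat.card (Sym2 (Fin c)) := by
  have := Fintype.ofFinite K
  have hGL := Matrix.card_GL_field (𝔽 := K) c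
  rw [← Nat.card_eq_fintype_card] at hGL
  rw [← hGL, ← card_isSymm, ← Nat.card_prod]
  have hd : ∀ (C E : Matrix (Fin c) (Fin c) K),
      (fromBlocks (0 : Matrix (Fin c) (Fin c) K) C Cᵀ E).det ≠ 0 ↔ C.det ≠ 0 := by
    intro C E
    constructor
    · intro h h0
      rw [← det_transpose] at h0
      obtain ⟨x, hx, hx0⟩ := exists_mulVec_eq_zero_iff.2 h0
      exact hx (injective_of_det_fromBlocks_ne_zero h x hx0)
    · intro h h0
      obtain ⟨x, hx, hx0⟩ := exists_mulVec_eq_zero_iff.2 h0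
      rw [fromBlocks_mulVec] at hx0
      have h2 : x ∘ Sum.inr = 0 := eq_zero_of_mulVec_eq_zero h (by
        ext i; simpa using congrFun hx0 (Sum.inl i))
      have h1 : x ∘ Sum.inl = 0 := eq_zero_of_mulVec_eq_zero (M := Cᵀ) (by rwa [det_transpose]) (by
        ext i; simpa [h2] using congrFun hx0 (Sum.inr i))
      exact hx (funext fun i => i.casesOn (congrFun h1) (congrFun h2))
  refine Nat.card_congr
    { toFun := fun p => (GeneralLinearGroup.mkOfDetNeZero p.1.1 ((hd _ _).1 p.2.2), ⟨p.1.2, p.2.1⟩)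
      invFun := fun p => ⟨(p.1.1, p.2.1), p.2.2, (hd _ _).2 p.1.det_ne_zero⟩
      left_inv := fun p => rfl
      right_inv := fun p => by ext <;> rfl }

end Border

/-! ### Symmetric matrices supported on a graph -/

/-- `[Z°_G]` is regular for all finite simple graphs `G`. -/
def StembridgeRegular : Prop :=
  ∀ (n : ℕ) (G : SimpleGraph (Fin n)), IsRegular (fun K _ => (countZo G K : ℚ))

section Support

variable {ι κ : Type} [Fintype ι] [DecidableEq ι] [Fintype κ] [DecidableEq κ]

/-- The symmetric matrices whose off-diagonal entries vanish outside the edges of `G`. -/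
abbrev SupportedSymm (G : SimpleGraph ι) (K : Type) [Field K] : Type :=
  {M : Matrix ι ι K // M.IsSymm ∧ ∀ i j, i ≠ j → ¬ G.Adj i j → M i j = 0}

/-- The number of nondegenerate symmetric matrices whose off-diagonal entries vanish outside the
edges of `G`. -/
def nondegCount (G : SimpleGraph ι) (K : Type) [Field K] : ℕ :=
  Nat.card {M : Matrix ι ι K // M.IsSymm ∧ M.det ≠ 0 ∧ ∀ i j, i ≠ j → ¬ G.Adj i j → M i j = 0}

theorem nondegCount_comap (G : SimpleGraph ι) (e : κ ≃ ι) (K : Type) [Field K] :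
    nondegCount (G.comap e) K = nondegCount G K := by
  symm
  refine Nat.card_congr (Equiv.subtypeEquiv (Matrix.reindex e.symm e.symm) fun M => ?_)
  simp only [reindex_apply, Equiv.symm_symm]
  rw [det_submatrix_equiv_self]
  refine and_congr ⟨fun h => h.submatrix e, fun h => ?_⟩ (and_congr_right fun _ =>
    ⟨fun h i j hij hG => ?_, fun h i j hij hG => ?_⟩)
  · simpa using h.submatrix e.symm
  · exact h _ _ (e.injective.ne hij) hG
  · simpa using h (e.symm i) (e.symm j) (e.symm.injective.ne hij) (by simpa using hG)

theorem isRegular_nondegCount (H : StembridgeRegular) (G : SimpleGraph ι) :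
    IsRegular (fun K _ => (nondegCount G K : ℚ)) := by
  let e := (Fintype.equivFin ι).symm
  refine (H _ (G.comap e)).congr fun K _ _ => ?_
  rw [← nondegCount_comap G e]
  rfl

/-- The join of `G` with the complete graph on `κ`. -/
def cone (G : SimpleGraph ι) (κ : Type) : SimpleGraph (ι ⊕ κ) where
  Adj x y := x ≠ y ∧ ∀ i j, x = Sum.inl i → y = Sum.inl j → G.Adj i j
  symm := ⟨fun _ _ h => ⟨h.1.symm, fun i j hi hj => (h.2 j i hj hi).symm⟩⟩
  loopless := ⟨fun _ h => h.1 rfl⟩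

/-- The added vertices are adjacent to all others, so the border of `A` is constrained by symmetry
only. -/
theorem nondegCount_cone (G : SimpleGraph ι) (K : Type) [Field K] [Finite K]
    [Fintype (SupportedSymm G K)] :
    nondegCount (cone G κ) K = ∑ A : SupportedSymm G K, borderCount A.1 κ := by
  have := Fintype.ofFinite K
  simp only [borderCount]
  rw [← Nat.card_sigma]
  refine Nat.card_congr
    { toFun := fun M => ⟨⟨M.1.toBlocks₁₁, ?_⟩, ⟨(M.1.toBlocks₁₂, M.1.toBlocks₂₂), ?_⟩⟩
      invFun := fun p => ⟨fromBlocks p.1.1 p.2.1.1 p.2.1.1ᵀ p.2.1.2, ?_⟩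
      left_inv := fun M => ?_
      right_inv := fun p => ?_ }
  · obtain ⟨M, hs, hd, hM⟩ := M
    refine ⟨IsSymm.ext fun i j => hs.apply _ _, fun i j hij hG => ?_⟩
    exact hM _ _ (Sum.inl_injective.ne hij) fun h => hG (h.2 i j rfl rfl)
  · obtain ⟨M, hs, hd, hM⟩ := M
    refine ⟨IsSymm.ext fun i j => hs.apply _ _, ?_⟩
    have : M = fromBlocks M.toBlocks₁₁ M.toBlocks₁₂ M.toBlocks₁₂ᵀ M.toBlocks₂₂ := by
      ext (i | i) (j | j)
      · rfl
      · rfl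
      · exact hs.apply _ _
      · rfl
    rwa [← this]
  · obtain ⟨⟨A, hA, hG⟩, ⟨C, E⟩, hE, hd⟩ := p
    refine ⟨isSymm_fromBlocks_iff.2 ⟨hA, by simp, by simp, hE⟩, hd, ?_⟩
    rintro (i | i) (j | j) hij hn
    · exact hG i j (by simpa using hij) fun h => hn ⟨hij, by rintro _ _ ⟨⟩ ⟨⟩; exact h⟩
    · exact absurd ⟨hij, by rintro _ _ _ ⟨⟩⟩ hn
    · exact absurd ⟨hij, by rintro _ _ ⟨⟩⟩ hn
    · exact absurd ⟨hij, by rintro _ _ ⟨⟩⟩ hn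
  · obtain ⟨M, hs, hd, hM⟩ := M
    ext (i | i) (j | j)
    · rfl
    · rfl
    · exact hs.apply _ _
    · rfl
  · rfl

/-- The number of symmetric matrices of corank `k` whose off-diagonal entries vanish outside the
edges of `G`. -/
def corankCount (G : SimpleGraph ι) (k : ℕ) (K : Type) [Field K] : ℕ :=
  Nat.card {A : SupportedSymm G K // Fintype.card ι - A.1.rank = k}

theorem nondegCount_cone_eq_sum (G : SimpleGraph ι) (c : ℕ) (K : Type) [Field K] [Finite K] :
    nondegCount (cone G (Fin c)) K = ∑ k ∈ Finset.range (c + 1),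
      corankCount G k K * (Nat.card K ^ ((Fintype.card ι - k) * c) * zeroBlockCount k c K) := by
  classical
  have := Fintype.ofFinite (SupportedSymm G K)
  rw [nondegCount_cone]
  have hk : ∀ k, corankCount G k K =
      (Finset.univ.filter fun A : SupportedSymm G K => Fintype.card ι - A.1.rank = k).card := by
    intro k
    rw [corankCount, Nat.card_eq_fintype_card, Fintype.card_subtype]
  have hA : ∀ A : SupportedSymm G K, borderCount A.1 (Fin c) =
      ∑ k ∈ Finset.range (c + 1), if Fintype.card ι - A.1.rank = k then
        (Nat.card K ^ ((Fintype.card ι - k) * c) * zeroBlockCount k c K) else 0 := by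
    intro A
    have hle : A.1.rank ≤ Fintype.card ι := A.1.rank_le_card_width
    rw [borderCount_eq A.1 A.2.1, Finset.sum_ite_eq]
    split_ifs with h
    · rw [Nat.sub_sub_self hle]
    · rw [zeroBlockCount_of_lt (by rw [Finset.mem_range] at h; omega), mul_zero]
  simp_rw [hA]
  rw [Finset.sum_comm]
  refine Finset.sum_congr rfl fun k _ => ?_
  rw [hk, ← Finset.sum_filter, Finset.sum_const, smul_eq_mul]

theorem card_eq_support (k : ℕ) (S : Finset (Fin k)) (K : Type) [Field K] [Fintype K]
    [DecidableEq K] :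
    (Finset.univ.filter fun d : Fin k → K => Finset.univ.filter (fun i => d i ≠ 0) = S).card =
      (Nat.card K - 1) ^ S.card := by
  have : (Finset.univ.filter fun d : Fin k → K => Finset.univ.filter (fun i => d i ≠ 0) = S) =
      Fintype.piFinset fun i => if i ∈ S then ({0} : Finset K)ᶜ else {0} := by
    ext d
    simp only [Finset.mem_filter, Finset.mem_univ, true_and, Fintype.mem_piFinset,
      Finset.ext_iff]
    refine forall_congr' fun i => ?_
    by_cases h : i ∈ S <;> simp [h]
  rw [this, Fintype.card_piFinset]
  simp only [apply_ite Finset.card, Finset.card_compl, Finset.card_singleton, Finset.prod_ite,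
    Finset.prod_const_one, mul_one, Finset.prod_const, Nat.card_eq_fintype_card]
  simp

/-- The matrices supported on the empty graph are diagonal. They are sorted by the set `S` of
nonzero diagonal entries, whose size is the rank. -/
theorem nondegCount_cone_bot (k c : ℕ) (K : Type) [Field K] [Finite K] :
    nondegCount (cone (⊥ : SimpleGraph (Fin k)) (Fin c)) K = ∑ S : Finset (Fin k),
      (Nat.card K - 1) ^ S.card * (Nat.card K ^ (S.card * c) * zeroBlockCount (k - S.card) c K) := by
  classical
  have := Fintype.ofFinite K
  let e : (Fin k → K) ≃ SupportedSymm (⊥ : SimpleGraph (Fin k)) K :=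
    { toFun := fun d => ⟨diagonal d, isSymm_diagonal d, fun i j h _ => diagonal_apply_ne _ h⟩
      invFun := fun A => A.1.diag
      left_inv := fun d => by simp
      right_inv := fun A => by
        refine Subtype.ext (Matrix.ext fun i j => ?_)
        by_cases h : i = j
        · subst h; simp
        · exact (diagonal_apply_ne _ h).trans (A.2.2 i j h (by simp)).symm }
  have := Fintype.ofEquiv _ e
  rw [nondegCount_cone, ← e.sum_comp]
  have hd : ∀ d : Fin k → K, borderCount (e d).1 (Fin c) =
      ∑ S : Finset (Fin k), if Finset.univ.filter (fun i => d i ≠ 0) = S then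
        Nat.card K ^ (S.card * c) * zeroBlockCount (k - S.card) c K else 0 := by
    intro d
    rw [borderCount_eq _ (e d).2.1, Finset.sum_ite_eq, if_pos (Finset.mem_univ _)]
    have : (e d).1.rank = (Finset.univ.filter fun i => d i ≠ 0).card := by
      rw [← Fintype.card_subtype]
      exact rank_diagonal d
    rw [this, Fintype.card_fin]
  simp_rw [hd]
  rw [Finset.sum_comm]
  refine Finset.sum_congr rfl fun S _ => ?_
  rw [← card_eq_support, ← Finset.sum_filter, Finset.sum_const, smul_eq_mul]

/-- In the count for the cone over the empty graph, `S = ∅` contributes the wanted number and every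
other `S` a smaller zero block. -/
theorem isRegular_zeroBlockCount (H : StembridgeRegular) (k c : ℕ) :
    IsRegular (fun K _ => (zeroBlockCount k c K : ℚ)) := by
  induction k using Nat.strong_induction_on with
  | _ k ih =>
    refine ((isRegular_nondegCount H (cone (⊥ : SimpleGraph (Fin k)) (Fin c))).sub
      (IsRegular.sum ((Finset.univ : Finset (Finset (Fin k))).erase ∅)
        (F := fun S K _ => ((Nat.card K : ℚ) - 1) ^ S.card * ((Nat.card K : ℚ) ^ (S.card * c) *
          zeroBlockCount (k - S.card) c K)) fun S hS => ?_)).congr fun K _ _ => ?_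
    · have hpos : 0 < S.card :=
        Finset.card_pos.2 (Finset.nonempty_iff_ne_empty.2 (by simpa using hS))
      have hle : S.card ≤ k := by simpa using S.card_le_univ
      exact ((IsRegular.card.sub (.const 1)).pow _).mul
        ((IsRegular.card.pow _).mul (ih _ (by omega)))
    · rw [nondegCount_cone_bot, ← Finset.add_sum_erase _ _ (Finset.mem_univ ∅)]
      push_cast [Nat.cast_sub (one_le_two.trans (two_le_card K))]
      simp

/-- The cone with `c` added vertices sees coranks at most `c`, so the system is triangular. Solving
it requires division, which is why regular functions are used in place of polynomials. -/
theorem isRegular_corankCount (H : StembridgeRegular) (G : SimpleGraph ι) (c : ℕ) :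
    IsRegular (fun K _ => (corankCount G c K : ℚ)) := by
  induction c using Nat.strong_induction_on with
  | _ c ih =>
    -- The divisor is the coefficient of `corankCount G c`, computed by `zeroBlockCount_self`.
    refine IsRegular.of_mul (X ^ ((Fintype.card ι - c) * c) *
      ((∏ i : Fin c, (X ^ c - X ^ (i : ℕ))) * X ^ Nat.card (Sym2 (Fin c)))) (fun n hn => ?_)
      (((isRegular_nondegCount H (cone G (Fin c))).sub
      (IsRegular.sum (Finset.range c) (F := fun k K _ => (corankCount G k K : ℚ) *
        ((Nat.card K : ℚ) ^ ((Fintype.card ι - k) * c) * zeroBlockCount k c K))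
        fun k hk => ?_)).congr fun K _ _ => ?_)
    · have hn0 : (n : ℚ) ≠ 0 := by positivity
      simp only [eval_mul, eval_pow, eval_X, eval_prod, eval_sub]
      refine mul_ne_zero (pow_ne_zero _ hn0) (mul_ne_zero (Finset.prod_ne_zero_iff.2 fun i _ => ?_)
        (pow_ne_zero _ hn0))
      rw [sub_ne_zero]
      have : n ^ (i : ℕ) < n ^ c := Nat.pow_lt_pow_right hn i.2
      exact_mod_cast this.ne'
    · exact (ih k (Finset.mem_range.1 hk)).mul
        ((IsRegular.card.pow _).mul (isRegular_zeroBlockCount H k c))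
    · rw [nondegCount_cone_eq_sum, Finset.sum_range_succ, zeroBlockCount_self]
      have hsub : ∀ i : Fin c, ((Nat.card K ^ c - Nat.card K ^ (i : ℕ) : ℕ) : ℚ) =
          (Nat.card K : ℚ) ^ c - (Nat.card K : ℚ) ^ (i : ℕ) := by
        intro i
        rw [Nat.cast_sub (Nat.pow_le_pow_right (by have := two_le_card K; omega) i.2.le)]
        push_cast
        rfl
      push_cast [hsub]
      simp only [eval_mul, eval_pow, eval_X, eval_prod, eval_sub]
      ring

/-- The number of symmetric matrices of corank `k` whose off-diagonal entries are nonzero exactly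
at the edges of `G`. -/
def exactCount (G : SimpleGraph ι) (k : ℕ) (K : Type) [Field K] : ℕ :=
  Nat.card {A : Matrix ι ι K // A.IsSymm ∧ Fintype.card ι - A.rank = k ∧
    ∀ i j, i ≠ j → (G.Adj i j ↔ A i j ≠ 0)}

theorem corankCount_eq_sum (G : SimpleGraph ι) (k : ℕ) (K : Type) [Field K] [Finite K]
    [Fintype (SimpleGraph ι)] [DecidableLE (SimpleGraph ι)] :
    corankCount G k K = ∑ G' : SimpleGraph ι with G' ≤ G, exactCount G' k K := by
  classical
  have := Fintype.ofFinite K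
  rw [← Finset.sum_coe_sort]
  simp only [exactCount]
  rw [← Nat.card_sigma]
  let supp (A : Matrix ι ι K) (hA : A.IsSymm) : SimpleGraph ι :=
    { Adj := fun i j => i ≠ j ∧ A i j ≠ 0
      symm := ⟨fun i j h => ⟨h.1.symm, by rw [hA.apply]; exact h.2⟩⟩
      loopless := ⟨fun i h => h.1 rfl⟩ }
  refine Nat.card_congr
    { toFun := fun A => ⟨⟨supp A.1.1 A.1.2.1, ?_⟩, ⟨A.1.1, A.1.2.1, A.2, ?_⟩⟩
      invFun := fun p => ⟨⟨p.2.1, p.2.2.1, ?_⟩, p.2.2.2.1⟩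
      left_inv := fun A => rfl
      right_inv := fun p => ?_ }
  · obtain ⟨⟨A, hs, hA⟩, hr⟩ := A
    simp only [Finset.mem_filter, Finset.mem_univ, true_and]
    intro i j h
    by_contra hG
    exact h.2 (hA i j h.1 hG)
  · intro i j hij
    exact ⟨fun h => h.2, fun h => ⟨hij, h⟩⟩
  · obtain ⟨⟨G', hG'⟩, A, hs, hr, hA⟩ := p
    intro i j hij hG
    by_contra h0
    exact hG ((Finset.mem_filter.1 hG').2 ((hA i j hij).2 h0))
  · obtain ⟨⟨G', hG'⟩, A, hs, hr, hA⟩ := p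
    have : supp A hs = G' := by
      ext i j
      by_cases hij : i = j
      · subst hij; simp [supp]
      · rw [hA i j hij]; simp [supp, hij]
    subst this
    rfl

/-- Each supported matrix has an exact support graph `G' ≤ G`; the proper subgraphs are subtracted
by induction. -/
theorem isRegular_exactCount (H : StembridgeRegular) (k : ℕ) (G : SimpleGraph ι) :
    IsRegular (fun K _ => (exactCount G k K : ℚ)) := by
  classical
  have := Fintype.ofFinite (SimpleGraph ι)
  induction G using WellFoundedLT.induction with
  | _ G ih =>
    refine ((isRegular_corankCount H G k).sub (IsRegular.sum
      ((Finset.univ.filter fun G' : SimpleGraph ι => G' ≤ G).erase G)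
        (F := fun G' K _ => (exactCount G' k K : ℚ)) fun G' hG' => ?_)).congr fun K _ _ => ?_
    · simp only [Finset.mem_erase, Finset.mem_filter, Finset.mem_univ, true_and] at hG'
      exact ih G' (lt_of_le_of_ne hG'.2 hG'.1)
    · rw [corankCount_eq_sum, ← Finset.add_sum_erase _ _ (show G ∈ _ by simp)]
      push_cast
      ring

end Support

/-! ### Symmetric matrices of rank two supported on a complete tripartite graph -/

/-- The complete tripartite graph with parts of size three. -/
def tripartite : SimpleGraph (Fin 3 × Fin 3) where
  Adj x y := x.1 ≠ y.1
  symm := ⟨fun _ _ h => h.symm⟩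
  loopless := ⟨fun _ h => h rfl⟩

theorem det_submatrix_eq_zero_of_rank_lt {K ι : Type} [Field K] [Fintype ι] {n : ℕ}
    {A : Matrix ι ι K} (h : A.rank < n) (r s : Fin n → ι) : (A.submatrix r s).det = 0 := by
  by_contra hd
  have h1 := rank_of_isUnit _ ((Matrix.isUnit_iff_isUnit_det _).2 (isUnit_iff_ne_zero.2 hd))
  have h2 := A.rank_submatrix_le r s
  rw [h1, Fintype.card_fin] at h2
  omega

/-- Corank 7 in size 9 is rank 2, so all 3×3 minors vanish. -/
theorem exactCount_tripartite_of_two_ne_zero (K : Type) [Field K] (h2 : (2 : K) ≠ 0) :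
    exactCount tripartite 7 K = 0 := by
  refine @Nat.card_of_isEmpty _ ⟨fun ⟨A, hs, hr, hA⟩ => ?_⟩
  have hr3 : A.rank < 3 := by
    have : A.rank ≤ _ := A.rank_le_card_width
    simp at this hr
    omega
  have hz : ∀ a i j, i ≠ j → A (a, i) (a, j) = 0 := fun a i j hij => by
    by_contra h
    exact (hA (a, i) (a, j) (by simpa using hij)).2 h rfl
  have hnz : ∀ a b i j, a ≠ b → A (a, i) (b, j) ≠ 0 := fun a b i j hab =>
    (hA (a, i) (b, j) (by simp [hab])).1 hab
  have hdiag : ∀ a b, a ≠ b → A (a, 0) (a, 0) = 0 := by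
    intro a b hab
    -- The only diagonal entry of this minor is the one at `(a, 0)`, and it is multiplied by two
    -- entries at edges. Three vertices in part `a` keep the other diagonal entries out.
    have := det_submatrix_eq_zero_of_rank_lt hr3 ![(a, 0), (a, 1), (b, 0)] ![(a, 0), (a, 2), (b, 1)]
    rw [det_fin_three] at this
    simp [hz] at this
    simpa [hnz _ _ _ _ hab, hnz _ _ _ _ hab.symm] using this
  -- A symmetric 3×3 matrix with zero diagonal has determinant `2xyz`.
  have := det_submatrix_eq_zero_of_rank_lt hr3 ![(0, 0), (1, 0), (2, 0)] ![(0, 0), (1, 0), (2, 0)]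
  rw [det_fin_three] at this
  simp [hdiag 0 1 (by decide), hdiag 1 0 (by decide), hdiag 2 0 (by decide)] at this
  rw [hs.apply (0, 0) (1, 0), hs.apply (0, 0) (2, 0), hs.apply (1, 0) (2, 0)] at this
  have h : 2 * (A (0, 0) (1, 0) * A (0, 0) (2, 0) * A (1, 0) (2, 0)) = 0 := by
    linear_combination this
  simp [h2, hnz] at h

theorem exactCount_tripartite_two : exactCount tripartite 7 (ZMod 2) ≠ 0 := by
  let A : Matrix (Fin 3 × Fin 3) (Fin 3 × Fin 3) (ZMod 2) :=
    Matrix.of fun x y => if x.1 = y.1 then 0 else 1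
  have hle : A.rank ≤ 2 := by
    -- `A` is the Gram matrix of the alternating form on the plane over the field with two elements,
    -- at its three nonzero vectors, each taken three times.
    let B : Matrix (Fin 3 × Fin 3) (Fin 2) (ZMod 2) :=
      Matrix.of fun x i => ![![1, 0], ![0, 1], ![1, 1]] x.1 i
    let C : Matrix (Fin 2) (Fin 3 × Fin 3) (ZMod 2) :=
      Matrix.of fun i y => ![![0, 1, 1], ![1, 0, 1]] i y.1
    have : A = B * C := by
      ext x y
      revert x y
      simp only [A, B, C, Matrix.mul_apply, Fin.sum_univ_two, Matrix.of_apply]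
      decide
    rw [this]
    exact (rank_mul_le_left _ _).trans (rank_le_card_width _)
  have hge : ¬ A.rank < 2 := fun h => by
    have := det_submatrix_eq_zero_of_rank_lt h ![(0, 0), (1, 0)] ![(0, 0), (1, 0)]
    rw [det_fin_two] at this
    simp [A] at this
  have : Nonempty {A : Matrix (Fin 3 × Fin 3) (Fin 3 × Fin 3) (ZMod 2) // A.IsSymm ∧
      Fintype.card (Fin 3 × Fin 3) - A.rank = 7 ∧
        ∀ i j, i ≠ j → (tripartite.Adj i j ↔ A i j ≠ 0)} := by
    refine ⟨A, IsSymm.ext fun i j => by simp [A, eq_comm], ?_, fun i j _ => ?_⟩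
    · simp
      omega
    · simp [A, tripartite]
  exact Nat.card_pos.ne'

theorem not_stembridgeRegular : ¬ StembridgeRegular := fun H =>
  not_isRegular (fun K _ _ h => by rw [exactCount_tripartite_of_two_ne_zero K h, Nat.cast_zero])
    (Nat.cast_ne_zero.2 exactCount_tripartite_two) (isRegular_exactCount H 7 tripartite)

theorem not_stembridgeConjecture : ¬ StembridgeConjecture ℚ := fun H =>
  not_stembridgeRegular fun n G => (H n G).isRegular

/-! ### Graphs given by the two ends of each edge -/

section Ends

variable {V E : Type}

/-- The graph with vertices `V` and edges `E`, where the edge `e` has the ends `s e` and `t e`. -/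
def graphOfEnds (s t : E → V) : Graph V E where
  vertexSet := Set.univ
  edgeSet := Set.univ
  IsLink e x y := (s e = x ∧ t e = y) ∨ (s e = y ∧ t e = x)
  isLink_symm _ _ := ⟨fun _ _ h => h.symm⟩
  eq_or_eq_of_isLink_of_isLink := by
    rintro e x y v w (⟨rfl, rfl⟩ | ⟨rfl, rfl⟩) (⟨rfl, rfl⟩ | ⟨rfl, rfl⟩) <;> simp
  edge_mem_iff_exists_isLink e := by simpa using ⟨s e, t e, Or.inl ⟨rfl, rfl⟩⟩
  left_mem_of_isLink := by simp

/-- The edges in `T` connect all vertices: there is no nontrivial vertex set that no edge in `T`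
leaves. -/
def Connects (s t : E → V) (T : Finset E) : Prop :=
  ∀ f : V → Prop, (∀ e ∈ T, f (s e) ↔ f (t e)) → ∀ x y, f x ↔ f y

/-- The edges in `T` connect all vertices, and their number is the least possible. -/
def IsTreeSet [Fintype V] (s t : E → V) (T : Finset E) : Prop :=
  T.card + 1 = Fintype.card V ∧ Connects s t T

theorem bettiZero_restrict_eq_one_iff (s t : E → V) [Nonempty V] (T : Finset E) :
    bettiZero ((graphOfEnds s t).restrict (T : Set E)) = 1 ↔ Connects s t T := by
  have hadj : ∀ x y, ((graphOfEnds s t).restrict (T : Set E)).Adj x y ↔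
      ∃ e ∈ T, (s e = x ∧ t e = y) ∨ (s e = y ∧ t e = x) := fun x y => Iff.rfl
  rw [bettiZero, Nat.card_eq_one_iff_unique]
  constructor
  · rintro ⟨hsub, -⟩ f hf x y
    let F : (Quot fun x y : ((graphOfEnds s t).restrict (T : Set E)).vertexSet =>
        ((graphOfEnds s t).restrict (T : Set E)).Adj x y) → Prop :=
      Quot.lift (fun x => f x.1) (by
        rintro ⟨x, _⟩ ⟨y, _⟩ h
        obtain ⟨e, he, ⟨rfl, rfl⟩ | ⟨rfl, rfl⟩⟩ := (hadj x y).1 h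
        · exact propext (hf e he)
        · exact propext (hf e he).symm)
    exact iff_of_eq (congrArg F (Subsingleton.elim (Quot.mk _ ⟨x, trivial⟩)
      (Quot.mk _ ⟨y, trivial⟩)))
  · intro h
    obtain ⟨v⟩ := ‹Nonempty V›
    refine ⟨⟨?_⟩, ⟨Quot.mk _ ⟨v, trivial⟩⟩⟩
    rintro ⟨x, hx⟩ ⟨y, hy⟩
    refine (h (fun z => Quot.mk _ ⟨x, trivial⟩ = Quot.mk (fun x y :
      ((graphOfEnds s t).restrict (T : Set E)).vertexSet =>
        ((graphOfEnds s t).restrict (T : Set E)).Adj x y) ⟨z, trivial⟩) (fun e he => ?_) x y).1 rfl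
    have : Quot.mk (fun x y : ((graphOfEnds s t).restrict (T : Set E)).vertexSet =>
        ((graphOfEnds s t).restrict (T : Set E)).Adj x y) ⟨s e, trivial⟩ =
          Quot.mk _ ⟨t e, trivial⟩ :=
      Quot.sound ((hadj _ _).2 ⟨e, he, Or.inl ⟨rfl, rfl⟩⟩)
    rw [this]

variable [Fintype V]

theorem isTree_restrict_iff (s t : E → V) (T : Finset E) :
    IsTree ((graphOfEnds s t).restrict (T : Set E)) ↔ IsTreeSet s t T := by
  rcases isEmpty_or_nonempty V with hV | hV
  -- Without vertices neither side holds: there are no components, and `T.card + 1` is not zero.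
  · have h0 : bettiZero ((graphOfEnds s t).restrict (T : Set E)) = 0 := by
      refine @Nat.card_of_isEmpty _ ⟨?_⟩
      rintro ⟨x, _⟩
      exact hV.elim x
    simp [IsTree, IsTreeSet, h0]
  · have hv : ((graphOfEnds s t).restrict (T : Set E)).vertexSet.ncard = Fintype.card V := by
      rw [← Nat.card_eq_fintype_card, ← Set.ncard_univ]
      rfl
    have he : ((graphOfEnds s t).restrict (T : Set E)).edgeSet.ncard = T.card := by
      rw [← Set.ncard_coe_finset]
      exact congrArg Set.ncard (Set.univ_inter (T : Set E))
    rw [IsTree, IsTreeSet, ← bettiZero_restrict_eq_one_iff, bettiOne, hv, he, and_comm]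
    refine and_congr_left fun h => ?_
    rw [h]
    omega

theorem isSpanningTree_iff (s t : E → V) (T : Finset (graphOfEnds s t).edgeSet) :
    IsSpanningTree (graphOfEnds s t) T ↔
      IsTreeSet s t (T.map (Function.Embedding.subtype _)) := by
  rw [← isTree_restrict_iff, IsSpanningTree, Finset.coe_map]
  rfl

variable [Fintype E]

open Classical in
/-- The value at `x` of the sum of the monomials `∏_{e ∈ T} x_e`, over all spanning trees `T`. -/
def treeSum (s t : E → V) {K : Type} [Field K] (x : E → K) : K :=
  ∑ T : Finset E with IsTreeSet s t T, ∏ e ∈ T, x e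

open Classical in
/-- The value at `x` of the sum of the monomials `∏_{e ∉ T} x_e`, over all spanning trees `T`. -/
def cotreeSum (s t : E → V) {K : Type} [Field K] (x : E → K) : K :=
  ∑ T : Finset E with IsTreeSet s t T, ∏ e ∈ Tᶜ, x e

open Classical in
theorem sum_isSpanningTree (s t : E → V) [Fintype (graphOfEnds s t).edgeSet] {R : Type}
    [AddCommMonoid R] (f : Finset E → R) :
    ∑ T : Finset (graphOfEnds s t).edgeSet with IsSpanningTree (graphOfEnds s t) T,
      f (T.map (Function.Embedding.subtype _)) = ∑ T : Finset E with IsTreeSet s t T, f T := by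
  refine Finset.sum_bij (fun T _ => T.map (Function.Embedding.subtype _)) (fun T hT => ?_)
    (fun T _ T' _ h => Finset.map_injective _ h) (fun T hT => ?_) (fun _ _ => rfl)
  · simpa [isSpanningTree_iff] using hT
  · have : (T.subtype (· ∈ (graphOfEnds s t).edgeSet)).map (Function.Embedding.subtype _) = T :=
      Finset.subtype_map_of_mem fun _ _ => trivial
    refine ⟨T.subtype _, ?_, this⟩
    simp only [Finset.mem_filter, Finset.mem_univ, true_and] at hT ⊢
    rwa [isSpanningTree_iff, this]

theorem countX_graphOfEnds (s t : E → V) [Fintype (graphOfEnds s t).edgeSet] (K : Type) [Field K] :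
    countX (graphOfEnds s t) K = Nat.card {x : E → K // treeSum s t x ≠ 0} := by
  classical
  let ε : (graphOfEnds s t).edgeSet ≃ E := Equiv.Set.univ E
  refine (Nat.card_congr (Equiv.subtypeEquiv (ε.arrowCongr (Equiv.refl K)).symm fun x => ?_)).symm
  refine not_congr (Eq.congr_left ?_)
  rw [polyQ, map_sum, treeSum, ← sum_isSpanningTree]
  refine Finset.sum_congr rfl fun T _ => ?_
  rw [map_prod, Finset.prod_map]
  simp only [MvPolynomial.aeval_X]
  rfl

theorem countY_graphOfEnds (s t : E → V) [Fintype (graphOfEnds s t).edgeSet] (K : Type) [Field K] :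
    countY (graphOfEnds s t) K = Nat.card {x : E → K // cotreeSum s t x ≠ 0} := by
  classical
  let ε : (graphOfEnds s t).edgeSet ≃ E := Equiv.Set.univ E
  refine (Nat.card_congr (Equiv.subtypeEquiv (ε.arrowCongr (Equiv.refl K)).symm fun x => ?_)).symm
  refine not_congr (Eq.congr_left ?_)
  rw [polyP, map_sum, cotreeSum, ← sum_isSpanningTree]
  refine Finset.sum_congr rfl fun T _ => ?_
  have : (T.map (Function.Embedding.subtype _))ᶜ = Tᶜ.map (Function.Embedding.subtype _) := by
    ext e
    have he : e ∈ (graphOfEnds s t).edgeSet := trivial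
    simp [he]
  rw [map_prod, this, Finset.prod_map]
  simp only [MvPolynomial.aeval_X]
  rfl

end Ends

/-! ### The matrix tree theorem -/

section MatrixTree

open Matrix

variable {ι E : Type} [Fintype ι] [DecidableEq ι]

/-- The incidence matrix, without the row of the vertex `none`. -/
def incidence (s t : E → Option ι) (R : Type) [CommRing R] : Matrix ι E R :=
  Matrix.of fun i e => (if s e = some i then 1 else 0) - (if t e = some i then 1 else 0)

theorem vecMul_incidence (s t : E → Option ι) {R : Type} [CommRing R] (g : ι → R) (e : E) :
    (g ᵥ* incidence s t R) e = (s e).elim 0 g - (t e).elim 0 g := by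
  have h : ∀ v : Option ι, ∑ i, g i * (if v = some i then 1 else 0) = v.elim 0 g := by
    rintro (_ | v) <;> simp
  simp only [vecMul, dotProduct, incidence, of_apply, mul_sub, Finset.sum_sub_distrib, h]

/-- The left kernel consists of the functions on the vertices that vanish at `none` and are constant
along the edges of `T`. -/
theorem det_incidence_ne_zero_iff (s t : E → Option ι) (F : Type) [Field F] (T : Finset E)
    (σ : ι ≃ T) :
    ((incidence s t F).submatrix id (fun i => (σ i : E))).det ≠ 0 ↔ Connects s t T := by
  have hmul : ∀ (g : ι → F) (i : ι),
      (g ᵥ* (incidence s t F).submatrix id (fun i => (σ i : E))) i =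
        (s (σ i)).elim 0 g - (t (σ i)).elim 0 g := fun g i => vecMul_incidence s t g (σ i)
  constructor
  · intro hd f hf
    by_contra hcon
    have hx : ∃ x, ¬ (f x ↔ f none) := by
      by_contra! h
      exact hcon fun x y => (h x).trans (h y).symm
    classical
    let g : ι → F := fun i => if f (some i) ↔ f none then 0 else 1
    have hg : ∀ v : Option ι, v.elim 0 g = if f v ↔ f none then 0 else 1 := by
      rintro (_ | v) <;> simp [g]
    have hg0 : g = 0 := by
      refine eq_zero_of_vecMul_eq_zero hd (funext fun i => ?_)
      rw [hmul, hg, hg, Pi.zero_apply]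
      simp only [hf (σ i) (σ i).2, sub_self]
    obtain ⟨x, hx⟩ := hx
    have := hg x
    rw [if_neg hx, hg0] at this
    rcases x with _ | x <;> simp at this
  · intro hT hd
    obtain ⟨g, hg, hg0⟩ := exists_vecMul_eq_zero_iff.2 hd
    refine hg (funext fun i => ?_)
    refine (hT (fun v => v.elim 0 g = 0) (fun e he => ?_) none (some i)).1 rfl
    have := congrFun hg0 (σ.symm ⟨e, he⟩)
    rw [hmul, Equiv.apply_symm_apply, Pi.zero_apply, sub_eq_zero] at this
    simp only [this]

/-- The determinant comes from an integer. If `T` connects, no prime divides it, so it is `±1`;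
otherwise it vanishes over `ℚ`. -/
theorem det_incidence_sq (s t : E → Option ι) (K : Type) [Field K] (T : Finset E)
    (σ : ι ≃ T) [Decidable (Connects s t T)] :
    ((incidence s t K).submatrix id (fun i => (σ i : E))).det ^ 2 =
      if Connects s t T then 1 else 0 := by
  let D : ℤ := ((incidence s t ℤ).submatrix id (fun i => (σ i : E))).det
  have hD : ∀ (F : Type) [Field F],
      ((incidence s t F).submatrix id (fun i => (σ i : E))).det = (D : F) := by
    intro F _
    rw [← eq_intCast (Int.castRingHom F), RingHom.map_det]
    congr 1
    ext i j
    simp only [incidence, RingHom.mapMatrix_apply, map_apply, submatrix_apply, of_apply, map_sub]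
    split_ifs <;> simp
  rw [hD]
  split_ifs with h
  · have : D.natAbs = 1 := by
      by_contra hne
      obtain ⟨p, hp, hdvd⟩ := Nat.exists_prime_and_dvd hne
      have : Fact p.Prime := ⟨hp⟩
      refine (det_incidence_ne_zero_iff s t (ZMod p) T σ).2 h ?_
      rw [hD, ZMod.intCast_zmod_eq_zero_iff_dvd]
      exact Int.natCast_dvd.2 hdvd
    have h2 : D ^ 2 = 1 := by rw [← Int.natAbs_sq, this]; rfl
    exact_mod_cast congrArg (Int.cast : ℤ → K) h2
  · have h0 : (D : ℚ) = 0 := by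
      by_contra hne
      rw [← hD] at hne
      exact h ((det_incidence_ne_zero_iff s t ℚ T σ).1 hne)
    rw [Int.cast_eq_zero.1 h0]
    simp

theorem det_mul_eq_sum [Fintype E] {R : Type} [CommRing R] (M : Matrix ι E R) (N : Matrix E ι R) :
    (M * N).det = ∑ f : ι → E, (∏ i, M i (f i)) * (N.submatrix f id).det := by
  have h : (M * N) = fun i => ∑ e, M i e • N e := by
    ext i j
    simp [Matrix.mul_apply]
  rw [h]
  change (detRowAlternating : (ι → R) [⋀^ι]→ₗ[R] R).toMultilinearMap _ = _
  rw [MultilinearMap.map_sum]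
  refine Finset.sum_congr rfl fun f _ => ?_
  rw [MultilinearMap.map_smul_univ, smul_eq_mul]
  rfl

variable [Fintype E] [DecidableEq E]

open Classical in
-- This is the Cauchy–Binet term of `T`. If `T` has the right size, the maps with image `T` are the
-- permutations of one enumeration and add up to a squared minor; otherwise a row repeats.
theorem sum_image_eq (s t : E → Option ι) {K : Type} [Field K] (x : E → K) (T : Finset E) :
    ∑ f : ι → E with Finset.univ.image f = T, (∏ i, (incidence s t K * diagonal x) i (f i)) *
      ((incidence s t K)ᵀ.submatrix f id).det = if IsTreeSet s t T then ∏ e ∈ T, x e else 0 := by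
  by_cases hc : T.card = Fintype.card ι
  · let σ : ι ≃ T := Fintype.equivOfCardEq (by simp [hc])
    have hT : IsTreeSet s t T ↔ Connects s t T := by simp [IsTreeSet, hc]
    let D := (incidence s t K).submatrix id (fun i => (σ i : E))
    have hD := det_incidence_sq s t K T σ
    have hprod : ∀ π : Equiv.Perm ι, ∏ i, x (σ (π i)) = ∏ e ∈ T, x e := by
      intro π
      rw [Equiv.prod_comp π (fun i => x (σ i)), σ.prod_comp (fun e => x e), Finset.prod_coe_sort]
    have hsum : ∑ f : ι → E with Finset.univ.image f = T,
        (∏ i, (incidence s t K * diagonal x) i (f i)) *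
          ((incidence s t K)ᵀ.submatrix f id).det =
        ∑ π : Equiv.Perm ι, (∏ i, (incidence s t K * diagonal x) i (σ (π i))) *
          ((incidence s t K)ᵀ.submatrix (fun i => (σ (π i) : E)) id).det := by
      refine (Finset.sum_bij (fun π _ i => (σ (π i) : E)) (fun π _ => ?_) (fun π _ π' _ h => ?_)
        (fun f hf => ?_) (fun _ _ => rfl)).symm
      · simp only [Finset.mem_filter, Finset.mem_univ, true_and]
        ext e
        simp only [Finset.mem_image, Finset.mem_univ, true_and]
        constructor
        · rintro ⟨i, rfl⟩
          exact (σ (π i)).2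
        · intro he
          exact ⟨π.symm (σ.symm ⟨e, he⟩), by simp⟩
      · ext i
        exact σ.injective (Subtype.ext (congrFun h i))
      · simp only [Finset.mem_filter, Finset.mem_univ, true_and] at hf
        have hmem : ∀ i, f i ∈ T := fun i => by rw [← hf]; simp
        have hsurj : Function.Surjective fun i => σ.symm ⟨f i, hmem i⟩ := by
          intro j
          obtain ⟨i, -, hi⟩ := Finset.mem_image.1 (hf.ge (σ j).2)
          exact ⟨i, by simp [hi]⟩
        refine ⟨Equiv.ofBijective _ (Finite.injective_iff_bijective.1
          (Finite.injective_iff_surjective.2 hsurj)), Finset.mem_univ _, ?_⟩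
        ext i
        simp
    have hterm : ∀ π : Equiv.Perm ι, (∏ i, (incidence s t K * diagonal x) i (σ (π i))) *
          ((incidence s t K)ᵀ.submatrix (fun i => (σ (π i) : E)) id).det =
        ((∏ e ∈ T, x e) * D.det) * ((Equiv.Perm.sign π : ℤ) * ∏ i, D i (π i)) := by
      intro π
      have h1 : (incidence s t K)ᵀ.submatrix (fun i => (σ (π i) : E)) id = Dᵀ.submatrix π id := rfl
      rw [h1, det_permute, det_transpose]
      simp only [mul_diagonal, Finset.prod_mul_distrib, hprod]
      have h2 : ∀ i, incidence s t K i (σ (π i)) = D i (π i) := fun i => rfl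
      simp only [h2]
      ring
    rw [hsum]
    simp only [hterm]
    rw [← Finset.mul_sum]
    have : ∑ π : Equiv.Perm ι, ((Equiv.Perm.sign π : ℤ) : K) * ∏ i, D i (π i) = D.det := by
      rw [← det_transpose, det_apply']
      rfl
    rw [this, mul_assoc, ← sq, hD, hT]
    split_ifs <;> simp
  · have hT : ¬ IsTreeSet s t T := fun h => hc (by simpa using h.1)
    rw [if_neg hT]
    refine Finset.sum_eq_zero fun f hf => ?_
    have hf := (Finset.mem_filter.1 hf).2
    have hinj : ¬ Function.Injective f := fun h =>
      hc (by rw [← hf, Finset.card_image_of_injective _ h, Finset.card_univ])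
    simp only [Function.Injective, not_forall] at hinj
    obtain ⟨i, j, hij, hne⟩ := hinj
    rw [det_zero_of_row_eq hne (by ext k; simp [hij]), mul_zero]

/-- The matrix tree theorem. -/
theorem det_laplacian (s t : E → Option ι) {K : Type} [Field K] (x : E → K) :
    (incidence s t K * diagonal x * (incidence s t K)ᵀ).det = treeSum s t x := by
  classical
  rw [det_mul_eq_sum, treeSum, Finset.sum_filter,
    ← Finset.sum_fiberwise Finset.univ (fun f : ι → E => Finset.univ.image f)]
  exact Finset.sum_congr rfl fun T _ => by convert sum_image_eq s t x T

end MatrixTree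

/-! ### The join of a simple graph with a vertex -/

section Apex

open Matrix

variable {n : ℕ} (G : SimpleGraph (Fin n))

/-- The edges of the join of `G` with a vertex. -/
abbrev ApexEdge : Type := Fin n ⊕ {p : Fin n × Fin n // p.1 < p.2 ∧ G.Adj p.1 p.2}

/-- The first end of an edge of the join of `G` with the vertex `none`. -/
def apexSource : ApexEdge G → Option (Fin n)
  | Sum.inl i => some i
  | Sum.inr p => some p.1.1

/-- The second end of an edge of the join of `G` with the vertex `none`. -/
def apexTarget : ApexEdge G → Option (Fin n)
  | Sum.inl _ => none
  | Sum.inr p => some p.1.2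

variable {K : Type} [Field K]

instance : Fintype {p : Fin n × Fin n // p.1 < p.2 ∧ G.Adj p.1 p.2} := Fintype.ofFinite _

open Classical in
/-- The reduced weighted Laplacian of the join of `G` with a vertex. -/
def apexLaplacian (x : ApexEdge G → K) : Matrix (Fin n) (Fin n) K :=
  incidence (apexSource G) (apexTarget G) K * diagonal x *
    (incidence (apexSource G) (apexTarget G) K)ᵀ

theorem apexLaplacian_isSymm (x : ApexEdge G → K) : (apexLaplacian G x).IsSymm := by
  rw [apexLaplacian, IsSymm, transpose_mul, transpose_mul, transpose_transpose,
    diagonal_transpose, Matrix.mul_assoc]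

/-- The all-ones vector is killed by the edges of `G` and pairs to one with each edge to the apex.
-/
theorem apexLaplacian_mulVec_one (x : ApexEdge G → K) (i : Fin n) :
    ∑ j, apexLaplacian G x i j = x (Sum.inl i) := by
  classical
  have h1 : (1 : Fin n → K) ᵥ* incidence (apexSource G) (apexTarget G) K =
      Sum.elim (fun _ => 1) (fun _ => 0) := by
    ext (k | p) <;> rw [vecMul_incidence] <;> simp [apexSource, apexTarget]
  have h : ∑ j, apexLaplacian G x i j = (apexLaplacian G x *ᵥ 1) i := by
    simp [mulVec, dotProduct]
  rw [h, apexLaplacian, ← mulVec_mulVec, mulVec_transpose, h1]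
  simp only [mulVec, dotProduct, mul_diagonal, Fintype.sum_sum_type, Sum.elim_inl, Sum.elim_inr]
  simp [incidence, apexSource, apexTarget]

theorem apexLaplacian_apply_of_lt (x : ApexEdge G → K) {i j : Fin n} (hij : i < j) :
    (∀ h : G.Adj i j, apexLaplacian G x i j = - x (Sum.inr ⟨(i, j), hij, h⟩)) ∧
      (¬ G.Adj i j → apexLaplacian G x i j = 0) := by
  classical
  have h : apexLaplacian G x i j = ∑ p : {p : Fin n × Fin n // p.1 < p.2 ∧ G.Adj p.1 p.2},
      if p.1 = (i, j) then - x (Sum.inr p) else 0 := by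
    rw [apexLaplacian, Matrix.mul_apply]
    simp only [mul_diagonal, Fintype.sum_sum_type, transpose_apply, incidence, of_apply, apexSource,
      apexTarget]
    rw [Finset.sum_eq_zero, zero_add]
    · refine Finset.sum_congr rfl fun p _ => ?_
      obtain ⟨⟨a, b⟩, hab, hG⟩ := p
      simp only [Option.some.injEq, Prod.mk.injEq]
      have hab' : a < b := hab
      split_ifs <;> first | (exfalso; omega) | simp
    · intro k _
      by_cases h1 : k = i
      · have : k ≠ j := by omega
        simp [this]
      · simp [h1]
  rw [h]
  constructor
  · intro hG
    rw [Finset.sum_eq_single ⟨(i, j), hij, hG⟩]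
    · simp
    · intro p _ hp
      rw [if_neg fun h => hp (Subtype.ext h)]
    · simp
  · intro hG
    refine Finset.sum_eq_zero fun p _ => if_neg fun h => hG ?_
    have := p.2.2
    rwa [h] at this

/-- The Laplacian is a bijection from edge weights to supported symmetric matrices: row sums recover
the apex edges, and negated off-diagonal entries the edges of `G`. -/
theorem countZo_eq_card_treeSum (K : Type) [Field K] : countZo G K =
    Nat.card {x : ApexEdge G → K // treeSum (apexSource G) (apexTarget G) x ≠ 0} := by
  classical
  let Y (M : Matrix (Fin n) (Fin n) K) : ApexEdge G → K :=
    Sum.elim (fun i => ∑ j, M i j) (fun p => - M p.1.1 p.1.2)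
  have hoff : ∀ x : ApexEdge G → K, ∀ i j, i ≠ j → ¬ G.Adj i j → apexLaplacian G x i j = 0 := by
    intro x i j hij hG
    rcases lt_or_gt_of_ne hij with h | h
    · exact (apexLaplacian_apply_of_lt G x h).2 hG
    · rw [← (apexLaplacian_isSymm G x).apply]
      exact (apexLaplacian_apply_of_lt G x h).2 fun h => hG h.symm
  have hYL : ∀ x, Y (apexLaplacian G x) = x := by
    intro x
    ext (i | ⟨⟨i, j⟩, hij, hG⟩)
    · exact apexLaplacian_mulVec_one G x i
    · simp only [Y, Sum.elim_inr]
      rw [(apexLaplacian_apply_of_lt G x hij).1 hG, neg_neg]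
  have hLY : ∀ M : Matrix (Fin n) (Fin n) K, M.IsSymm →
      (∀ i j, i ≠ j → ¬ G.Adj i j → M i j = 0) → apexLaplacian G (Y M) = M := by
    intro M hs hM
    have hlt : ∀ i j, i < j → apexLaplacian G (Y M) i j = M i j := by
      intro i j hij
      by_cases hG : G.Adj i j
      · rw [(apexLaplacian_apply_of_lt G _ hij).1 hG]
        simp [Y]
      · rw [(apexLaplacian_apply_of_lt G _ hij).2 hG, hM i j hij.ne hG]
    have hne : ∀ i j, i ≠ j → apexLaplacian G (Y M) i j = M i j := by
      intro i j hij
      rcases lt_or_gt_of_ne hij with h | h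
      · exact hlt i j h
      · rw [← (apexLaplacian_isSymm G _).apply, hlt j i h, hs.apply]
    ext i j
    by_cases hij : i = j
    · subst hij
      have h := apexLaplacian_mulVec_one G (Y M) i
      rw [← Finset.add_sum_erase _ _ (Finset.mem_univ i)] at h
      simp only [Y, Sum.elim_inl] at h
      rw [← Finset.add_sum_erase _ (fun j => M i j) (Finset.mem_univ i),
        Finset.sum_congr rfl fun j hj => hne i j (Finset.ne_of_mem_erase hj).symm] at h
      exact add_right_cancel h
    · exact hne i j hij
  have hdet : ∀ x : ApexEdge G → K, (apexLaplacian G x).det =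
      treeSum (apexSource G) (apexTarget G) x := fun x => det_laplacian _ _ x
  exact Nat.card_congr
    { toFun := fun M => ⟨Y M.1, by rw [← hdet, hLY _ M.2.1 M.2.2.2]; exact M.2.2.1⟩
      invFun := fun x => ⟨apexLaplacian G x.1, apexLaplacian_isSymm G _, by
        rw [hdet]; exact x.2, hoff _⟩
      left_inv := fun M => Subtype.ext (hLY _ M.2.1 M.2.2.2)
      right_inv := fun x => Subtype.ext (hYL _) }

end Apex

theorem not_isRegular_treeSum : ¬ ∀ (V E : Type) [Fintype V] [Fintype E] (s t : E → V),
    IsRegular (fun K _ => (Nat.card {x : E → K // treeSum s t x ≠ 0} : ℚ)) := fun H =>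
  not_stembridgeRegular fun _ G => (H _ _ (apexSource G) (apexTarget G)).congr fun K _ _ => by
    rw [countZo_eq_card_treeSum]

theorem not_stanleyConjecture : ¬ StanleyConjecture ℚ := fun H =>
  not_isRegular_treeSum fun V E _ _ s t => by
    have := Fintype.ofFinite (graphOfEnds s t).edgeSet
    refine (H V E (graphOfEnds s t)).isRegular.congr fun K _ _ => ?_
    rw [countX_graphOfEnds]

/-! ### Contraction and deletion of edges -/

section Minors

open scoped Classical

variable {V E : Type} [Fintype V]

/-- The map taking a function on the vertices to its differences along `T` has only constants in its
kernel; rank-nullity gives the bound. -/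
theorem Connects.card_le {s t : E → V} {T : Finset E} (h : Connects s t T) :
    Fintype.card V ≤ T.card + 1 := by
  let φ : (V → ℚ) →ₗ[ℚ] (T → ℚ) :=
    LinearMap.pi fun e => (LinearMap.proj (s e) : (V → ℚ) →ₗ[ℚ] ℚ) - LinearMap.proj (t e)
  have hker : LinearMap.ker φ ≤ Submodule.span ℚ {1} := by
    intro g hg
    rw [Submodule.mem_span_singleton]
    rcases isEmpty_or_nonempty V with hV | ⟨⟨v⟩⟩
    · exact ⟨0, Subsingleton.elim _ _⟩
    · refine ⟨g v, funext fun w => ?_⟩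
      have := (h (fun w => g v = g w) (fun e he => ?_) v w).1 rfl
      · simpa using this
      · have := congrFun (LinearMap.mem_ker.1 hg) ⟨e, he⟩
        simp only [φ, LinearMap.pi_apply, LinearMap.sub_apply, LinearMap.proj_apply,
          Pi.zero_apply, sub_eq_zero] at this
        rw [this]
  have h1 := φ.finrank_range_add_finrank_ker
  have h2 := (LinearMap.range φ).finrank_le
  have h3 := (Submodule.finrank_mono hker).trans (finrank_span_le_card _)
  simp only [Module.finrank_fintype_fun_eq_card, Fintype.card_coe, Set.toFinset_singleton,
    Finset.card_singleton] at h1 h2 h3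
  omega

theorem IsTreeSet.ne_of_mem {s t : E → V} {T : Finset E} (h : IsTreeSet s t T) {e : E}
    (he : e ∈ T) : s e ≠ t e := by
  intro hst
  have hc : Connects s t (T.erase e) := fun f hf => h.2 f fun e' he' => by
    by_cases hee : e' = e
    · rw [hee, hst]
    · exact hf e' (Finset.mem_erase.2 ⟨hee, he'⟩)
  have h1 := hc.card_le
  have h2 := h.1
  rw [Finset.card_erase_of_mem he] at h1
  have := Finset.card_pos.2 ⟨e, he⟩
  omega

/-- The inclusion of the edges other than `e`. -/
def otherEdges (e : E) : {f : E // f ≠ e} ↪ E := Function.Embedding.subtype _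

theorem notMem_map_otherEdges (e : E) (T : Finset {f : E // f ≠ e}) :
    e ∉ T.map (otherEdges e) := by
  simp [otherEdges]

/-- The map that identifies the vertex `v` with `u`. -/
def merge {u v : V} (h : u ≠ v) (w : V) : {w : V // w ≠ v} :=
  if hw : w = v then ⟨u, h⟩ else ⟨w, hw⟩

/-- Predicates on the merged vertices are the predicates on `V` that agree at the two ends of `e`.
-/
theorem isTreeSet_contract_iff {s t : E → V} {e : E} (h : s e ≠ t e)
    [Fintype {w : V // w ≠ t e}] (T : Finset {f : E // f ≠ e}) :
    IsTreeSet (fun f : {f : E // f ≠ e} => merge h (s f)) (fun f => merge h (t f)) T ↔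
      IsTreeSet s t (insert e (T.map (otherEdges e))) := by
  have hmerge : ∀ (g : V → Prop), (g (s e) ↔ g (t e)) → ∀ w, g (merge h w).1 ↔ g w := by
    intro g hg w
    unfold merge
    split_ifs with hw
    · rw [hw, hg]
    · rfl
  have hcard : Fintype.card {w : V // w ≠ t e} = Fintype.card V - 1 := by
    rw [Fintype.card_subtype_compl, Fintype.card_subtype_eq]
  have hpos : 0 < Fintype.card V := Fintype.card_pos_iff.2 ⟨t e⟩
  have hself : ∀ w : {w : V // w ≠ t e}, merge h w.1 = w := fun w => by
    simp [merge, w.2]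
  refine and_congr ?_ ⟨fun H g hg => ?_, fun H g hg => ?_⟩
  · rw [Finset.card_insert_of_notMem (notMem_map_otherEdges e T), Finset.card_map, hcard]
    omega
  · have he := hg e (Finset.mem_insert_self _ _)
    intro x y
    rw [← hmerge g he x, ← hmerge g he y]
    refine H (fun w => g w.1) (fun f hf => ?_) _ _
    rw [hmerge g he, hmerge g he]
    exact hg _ (Finset.mem_insert_of_mem (Finset.mem_map_of_mem (otherEdges e) hf))
  · intro x y
    have := H (fun w => g (merge h w)) (fun f hf => ?_) x.1 y.1
    · simpa only [hself] using this
    · rcases Finset.mem_insert.1 hf with rfl | hf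
      · simp [merge, h]
      · obtain ⟨f', hf', rfl⟩ := Finset.mem_map.1 hf
        exact hg f' hf'

theorem isTreeSet_delete_iff {s t : E → V} {e : E} (T : Finset {f : E // f ≠ e}) :
    IsTreeSet (fun f : {f : E // f ≠ e} => s f) (fun f => t f) T ↔
      IsTreeSet s t (T.map (otherEdges e)) := by
  rw [IsTreeSet, IsTreeSet, Finset.card_map]
  simp [Connects, otherEdges]

theorem exists_map_otherEdges {e : E} {T : Finset E} (he : e ∉ T) :
    ∃ T' : Finset {f : E // f ≠ e}, T'.map (otherEdges e) = T :=
  ⟨T.subtype _, Finset.subtype_map_of_mem fun _ hf => ne_of_mem_of_not_mem hf he⟩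

variable [Fintype E] {K : Type} [Field K]

theorem cotreeSum_eq_zero_of_loop {s t : E → V} {e : E} (h : s e = t e) {x : E → K}
    (hx : x e = 0) : cotreeSum s t x = 0 := by
  refine Finset.sum_eq_zero fun T hT => ?_
  have he : e ∉ T := fun he => (Finset.mem_filter.1 hT).2.ne_of_mem he h
  exact Finset.prod_eq_zero (by simpa using he) hx

/-- At `x e = 0` only the trees containing `e` survive, and these are the trees of the contraction.
-/
theorem cotreeSum_contract {s t : E → V} {e : E} (h : s e ≠ t e)
    [Fintype {w : V // w ≠ t e}] {x : E → K} (hx : x e = 0) :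
    cotreeSum s t x = cotreeSum (fun f : {f : E // f ≠ e} => merge h (s f))
      (fun f => merge h (t f)) (fun f => x f) := by
  rw [cotreeSum, cotreeSum, ← Finset.sum_filter_add_sum_filter_not _ (fun T => e ∈ T),
    Finset.sum_eq_zero (s := Finset.filter (fun T => e ∉ T) _), add_zero]
  · refine (Finset.sum_bij (fun T _ => insert e (T.map (otherEdges e))) (fun T hT => ?_)
      (fun T _ T' _ hTT' => ?_) (fun T hT => ?_) (fun T _ => ?_)).symm
    · simp only [Finset.mem_filter, Finset.mem_univ, true_and] at hT ⊢
      exact ⟨(isTreeSet_contract_iff h T).1 hT, Finset.mem_insert_self _ _⟩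
    · have := congrArg (fun S => S.erase e) hTT'
      simp only [Finset.erase_insert (notMem_map_otherEdges e _)] at this
      exact Finset.map_injective _ this
    · simp only [Finset.mem_filter, Finset.mem_univ, true_and] at hT
      obtain ⟨T', hT'⟩ := exists_map_otherEdges (Finset.notMem_erase e T)
      have hins : insert e (T'.map (otherEdges e)) = T := by rw [hT', Finset.insert_erase hT.2]
      refine ⟨T', ?_, hins⟩
      simp only [Finset.mem_filter, Finset.mem_univ, true_and]
      rw [isTreeSet_contract_iff h, hins]
      exact hT.1
    · have : (insert e (T.map (otherEdges e)))ᶜ = Tᶜ.map (otherEdges e) := by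
        ext f
        by_cases hf : f = e <;> simp [otherEdges, hf]
      have hprod : ∏ f ∈ (insert e (T.map (otherEdges e)))ᶜ, x f = ∏ f ∈ Tᶜ, x f.1 := by
        rw [this, Finset.prod_map]
        rfl
      convert hprod.symm
  · intro T hT
    exact Finset.prod_eq_zero (Finset.mem_compl.2 (Finset.mem_filter.1 hT).2) hx

theorem treeSum_delete {s t : E → V} {e : E} {x : E → K} (hx : x e = 0) :
    treeSum s t x = treeSum (fun f : {f : E // f ≠ e} => s f) (fun f => t f) (fun f => x f) := by
  rw [treeSum, treeSum, ← Finset.sum_filter_add_sum_filter_not _ (fun T => e ∈ T),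
    Finset.sum_eq_zero, zero_add]
  · refine (Finset.sum_bij (fun T _ => T.map (otherEdges e)) (fun T hT => ?_)
      (fun T _ T' _ hTT' => Finset.map_injective _ hTT') (fun T hT => ?_) (fun T _ => ?_)).symm
    · simp only [Finset.mem_filter, Finset.mem_univ, true_and] at hT ⊢
      exact ⟨(isTreeSet_delete_iff T).1 hT, notMem_map_otherEdges e T⟩
    · simp only [Finset.mem_filter, Finset.mem_univ, true_and] at hT
      obtain ⟨T', hT'⟩ := exists_map_otherEdges hT.2
      refine ⟨T', ?_, hT'⟩
      simp only [Finset.mem_filter, Finset.mem_univ, true_and]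
      rw [isTreeSet_delete_iff, hT']
      exact hT.1
    · rw [Finset.prod_map]
      rfl
  · intro T hT
    exact Finset.prod_eq_zero (Finset.mem_filter.1 hT).2 hx

theorem cotreeSum_eq_mul_treeSum_inv (s t : E → V) {x : E → K} (hx : ∀ e, x e ≠ 0) :
    cotreeSum s t x = (∏ e, x e) * treeSum s t (fun e => (x e)⁻¹) := by
  rw [cotreeSum, treeSum, Finset.mul_sum]
  refine Finset.sum_congr rfl fun T _ => ?_
  rw [Finset.prod_inv_distrib, ← Finset.prod_mul_prod_compl T]
  have : ∏ e ∈ T, x e ≠ 0 := Finset.prod_ne_zero_iff.2 fun e _ => hx e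
  rw [mul_right_comm, mul_inv_cancel₀ this, one_mul]

end Minors

/-! ### Restriction to the points with prescribed nonzero coordinates -/

section Torus

variable {E : Type} {K : Type} [Field K]

/-- The number of `x` with nonzero coordinates in `Z` such that `F x ≠ 0`. -/
def torusCount (F : (E → K) → K) (Z : Finset E) : ℕ :=
  Nat.card {x : E → K // (∀ e ∈ Z, x e ≠ 0) ∧ F x ≠ 0}

/-- The points are split according to whether `x e` vanishes; `F'` is the restriction of `F` to that
hyperplane. -/
theorem torusCount_insert [Finite K] [Finite E] [DecidableEq E] {e : E}
    (F : (E → K) → K) (F' : ({f : E // f ≠ e} → K) → K)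
    (hF : ∀ x : E → K, x e = 0 → F x = F' (fun f => x f)) {Z : Finset E} (he : e ∉ Z) :
    torusCount F Z = torusCount F (insert e Z) + torusCount F' (Z.subtype (· ≠ e)) := by
  classical
  have h1 : torusCount F (insert e Z) =
      Nat.card {x : {x : E → K // (∀ e ∈ Z, x e ≠ 0) ∧ F x ≠ 0} // ¬ x.1 e = 0} := by
    rw [Nat.card_congr (Equiv.subtypeSubtypeEquivSubtypeInter
      (fun x : E → K => (∀ e ∈ Z, x e ≠ 0) ∧ F x ≠ 0) (fun x => ¬ x e = 0))]
    refine Nat.card_congr (Equiv.subtypeEquivRight fun x => ?_)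
    rw [Finset.forall_mem_insert]
    tauto
  have h2 : torusCount F' (Z.subtype (· ≠ e)) =
      Nat.card {x : {x : E → K // (∀ e ∈ Z, x e ≠ 0) ∧ F x ≠ 0} // x.1 e = 0} := by
    let ext0 (y : {f : E // f ≠ e} → K) : E → K := fun f => if h : f = e then 0 else y ⟨f, h⟩
    have hext : ∀ y, (fun f : {f : E // f ≠ e} => ext0 y f) = y := by
      intro y
      ext f
      simp [ext0, f.2]
    have hexte : ∀ y, ext0 y e = 0 := fun y => by simp [ext0]
    refine Nat.card_congr
      { toFun := fun y => ⟨⟨ext0 y.1, fun f hf => ?_, ?_⟩, hexte _⟩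
        invFun := fun x => ⟨fun f => x.1.1 f, fun f hf => ?_, ?_⟩
        left_inv := fun y => Subtype.ext (hext _)
        right_inv := fun x => ?_ }
    · have hfe : f ≠ e := ne_of_mem_of_not_mem hf he
      simpa [ext0, hfe] using y.2.1 ⟨f, hfe⟩ (by simpa using hf)
    · rw [hF _ (hexte _), hext]
      exact y.2.2
    · exact x.1.2.1 f (by simpa using hf)
    · rw [← hF _ x.2]
      exact x.1.2.2
    · refine Subtype.ext (Subtype.ext (funext fun f => ?_))
      by_cases hf : f = e
      · subst hf
        exact (hexte _).trans x.2.symm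
      · simp [ext0, hf]
  rw [h1, h2, torusCount, ← Nat.card_sum]
  exact Nat.card_congr ((Equiv.sumComm _ _).trans (Equiv.sumCompl _)).symm

theorem torusCount_empty (F : (E → K) → K) :
    torusCount F ∅ = Nat.card {x : E → K // F x ≠ 0} :=
  Nat.card_congr (Equiv.subtypeEquivRight fun x => by simp)

theorem torusCount_zero (Z : Finset E) : torusCount (fun _ : E → K => 0) Z = 0 :=
  @Nat.card_of_isEmpty _ ⟨fun x => x.2.2 rfl⟩

/-- Inverting all coordinates turns one sum into the other, up to the nonzero factor `∏ x_e`. -/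
theorem torusCount_treeSum_univ {V : Type} [Fintype V] [Fintype E] (s t : E → V) :
    torusCount (treeSum s t (K := K)) Finset.univ =
      torusCount (cotreeSum s t (K := K)) Finset.univ := by
  refine Nat.card_congr (Equiv.subtypeEquiv (Equiv.inv (E → K)) fun x => ?_)
  simp only [Finset.mem_univ, forall_const, Equiv.inv_apply, Pi.inv_apply, ne_eq, inv_eq_zero]
  refine and_congr_right fun hx => ?_
  have h := cotreeSum_eq_mul_treeSum_inv s t (x := x⁻¹) fun e => inv_ne_zero (hx e)
  simp only [Pi.inv_apply, inv_inv] at h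
  rw [h, mul_eq_zero, not_or, and_iff_right]
  exact Finset.prod_ne_zero_iff.2 fun e _ => inv_ne_zero (hx e)

end Torus

/-- Induction on the number of coordinates required to be nonzero. Releasing the condition at `e`
adds the points with `x e = 0`: a count for the contraction, or nothing if `e` is a loop. -/
theorem isRegular_torusCount_cotreeSum
    (H : ∀ (V E : Type) [Fintype V] [Fintype E] (s t : E → V),
      IsRegular (fun K _ => (Nat.card {x : E → K // cotreeSum s t x ≠ 0} : ℚ))) (m : ℕ) :
    ∀ (V E : Type) [Fintype V] [Fintype E] (s t : E → V) (Z : Finset E), Z.card = m →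
      IsRegular (fun K _ => (torusCount (cotreeSum s t (K := K)) Z : ℚ)) := by
  classical
  induction m with
  | zero =>
    intro V E _ _ s t Z hZ
    rw [Finset.card_eq_zero.1 hZ]
    exact (H V E s t).congr fun K _ _ => by rw [torusCount_empty]
  | succ m ih =>
    intro V E _ _ s t Z hZ
    obtain ⟨e, he⟩ := Finset.card_pos.1 (hZ.symm ▸ m.succ_pos : 0 < Z.card)
    have hZe : (Z.erase e).card = m := by rw [Finset.card_erase_of_mem he, hZ]; rfl
    have hZs : ((Z.erase e).subtype (· ≠ e)).card = m := by
      rw [Finset.card_subtype, Finset.filter_true_of_mem, hZe]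
      exact fun f hf => Finset.ne_of_mem_erase hf
    by_cases h : s e = t e
    · refine (ih V E s t (Z.erase e) hZe).congr fun K _ _ => ?_
      rw [torusCount_insert (cotreeSum s t (K := K)) (fun _ => 0)
        (fun x hx => cotreeSum_eq_zero_of_loop h hx) (Finset.notMem_erase e Z), torusCount_zero,
        Finset.insert_erase he, add_zero]
    · refine ((ih V E s t (Z.erase e) hZe).sub (ih {w : V // w ≠ t e} {f : E // f ≠ e}
        (fun f => merge h (s f)) (fun f => merge h (t f)) _ hZs)).congr fun K _ _ => ?_
      rw [torusCount_insert (cotreeSum s t (K := K)) _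
        (fun x hx => cotreeSum_contract h hx) (Finset.notMem_erase e Z), Finset.insert_erase he]
      push_cast
      ring

/-- The induction starts at the full torus, where both sums have the same count, and releases the
conditions one at a time, each release adding a count for a deletion. -/
theorem isRegular_torusCount_treeSum
    (H : ∀ (V E : Type) [Fintype V] [Fintype E] (s t : E → V),
      IsRegular (fun K _ => (Nat.card {x : E → K // cotreeSum s t x ≠ 0} : ℚ))) (m : ℕ) :
    ∀ (V E : Type) [Fintype V] [Fintype E] (s t : E → V) (Z : Finset E),
      Z.card + m = Fintype.card E →
        IsRegular (fun K _ => (torusCount (treeSum s t (K := K)) Z : ℚ)) := by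
  classical
  induction m with
  | zero =>
    intro V E _ _ s t Z hZ
    rw [Finset.card_eq_iff_eq_univ Z |>.1 hZ]
    exact (isRegular_torusCount_cotreeSum H _ V E s t Finset.univ rfl).congr fun K _ _ => by
      rw [torusCount_treeSum_univ]
  | succ m ih =>
    intro V E _ _ s t Z hZ
    obtain ⟨e, he⟩ : ∃ e, e ∉ Z := by
      by_contra! h
      rw [Finset.eq_univ_of_forall h, Finset.card_univ] at hZ
      omega
    have hcard : Fintype.card {f : E // f ≠ e} = Fintype.card E - 1 := by
      rw [Fintype.card_subtype_compl, Fintype.card_subtype_eq]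
    have hZs : (Z.subtype (· ≠ e)).card = Z.card := by
      rw [Finset.card_subtype, Finset.filter_true_of_mem]
      exact fun f hf => ne_of_mem_of_not_mem hf he
    have hZi : (insert e Z).card = Z.card + 1 := Finset.card_insert_of_notMem he
    refine ((ih V E s t (insert e Z) (by omega)).add (ih V {f : E // f ≠ e} (fun f => s f)
      (fun f => t f) (Z.subtype (· ≠ e)) (by omega))).congr fun K _ _ => ?_
    rw [torusCount_insert (treeSum s t (K := K)) _ (fun x hx => treeSum_delete hx) he]
    push_cast
    rfl

theorem not_kontsevichConjecture : ¬ KontsevichConjecture ℚ := fun H =>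
  not_isRegular_treeSum fun V E _ _ s t =>
    (isRegular_torusCount_treeSum (fun V E _ _ s t => by
      have := Fintype.ofFinite (graphOfEnds s t).edgeSet
      refine (H V E (graphOfEnds s t)).isRegular.congr fun K _ _ => ?_
      rw [countY_graphOfEnds]) _ V E s t ∅ (zero_add _)).congr fun K _ _ => by
        rw [torusCount_empty]

/-! ### The Fano matroid -/

section VectorMatroid

variable {α : Type} [Finite α] {F W : Type} [Field F] [AddCommGroup W] [Module F W] (v : α → W)

theorem vectorMatroid_indep_iff {I : Set α} :
    (vectorMatroid F v).Indep I ↔ LinearIndepOn F v I := Iff.rfl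

theorem eRk_vectorMatroid (X : Set α) :
    (vectorMatroid F v).eRk X = Module.finrank F (Submodule.span F (v '' X)) := by
  obtain ⟨I, hI⟩ := (vectorMatroid F v).exists_isBasis X (Set.subset_univ X)
  have hli : LinearIndepOn F v I := hI.indep
  have hspan : Submodule.span F (v '' X) = Submodule.span F (v '' I) := by
    refine le_antisymm (Submodule.span_le.2 ?_) (Submodule.span_mono (Set.image_mono hI.subset))
    rintro _ ⟨e, he, rfl⟩
    by_cases heI : e ∈ I
    · exact Submodule.subset_span ⟨e, heI, rfl⟩
    · by_contra hv
      exact heI (hI.mem_of_insert_indep he (hli.insert hv))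
  have := Fintype.ofFinite I
  have h := finrank_span_eq_card (R := F) (b := fun i : I => v i) hli
  rw [hI.eRk_eq_encard, hspan, Set.image_eq_range, h, ← Nat.card_eq_fintype_card,
    Nat.card_coe_set_eq, (Set.toFinite I).cast_ncard_eq]

end VectorMatroid

theorem span_range_rep : Submodule.span (ZMod 2)
    (Set.range (Projectivization.rep (K := ZMod 2) (V := Fin 3 → ZMod 2))) = ⊤ := by
  refine Submodule.eq_top_iff'.2 fun u => ?_
  by_cases hu : u = 0
  · rw [hu]
    exact Submodule.zero_mem _
  · obtain ⟨a, ha⟩ := Projectivization.exists_smul_eq_mk_rep (ZMod 2) u hu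
    have : u = (a⁻¹ : (ZMod 2)ˣ) • (Projectivization.mk (ZMod 2) u hu).rep := by
      rw [← ha, inv_smul_smul]
    rw [this]
    exact Submodule.smul_mem _ _ (Submodule.subset_span ⟨_, rfl⟩)

theorem eRk_fanoMatroid (X : Set (Projectivization (ZMod 2) (Fin 3 → ZMod 2))) :
    fanoMatroid.eRk X = Module.finrank (ZMod 2) (Submodule.span (ZMod 2)
      (Projectivization.rep '' X)) := eRk_vectorMatroid _ X

theorem eRank_fanoMatroid : fanoMatroid.eRank = 3 := by
  rw [← Matroid.eRk_univ_eq, eRk_fanoMatroid, Set.image_univ,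
    span_range_rep, finrank_top, Module.finrank_fintype_fun_eq_card]
  rfl

theorem rank_fanoMatroid : rank fanoMatroid = 3 := by
  rw [rank, eRank_fanoMatroid]
  rfl

theorem two_dvd_card_iff (K : Type) [Field K] [Finite K] : 2 ∣ Nat.card K ↔ (2 : K) = 0 := by
  have := Fintype.ofFinite K
  rw [Nat.card_eq_fintype_card]
  constructor
  · intro h
    obtain ⟨p, hp⟩ := CharP.exists K
    obtain ⟨n, hpp, hn⟩ := FiniteField.card K p
    rw [hn] at h
    have h2 : 2 = p := (Nat.prime_dvd_prime_iff_eq Nat.prime_two hpp).1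
      (Nat.prime_two.dvd_of_dvd_pow h)
    subst h2
    exact_mod_cast CharP.cast_eq_zero K 2
  · intro h
    by_contra hodd
    obtain ⟨k, hk⟩ := Nat.not_even_iff_odd.1 (fun he => hodd he.two_dvd)
    have h0 := FiniteField.cast_card_eq_zero K
    rw [hk] at h0
    push_cast at h0
    rw [h, zero_mul, zero_add] at h0
    exact one_ne_zero h0

theorem isRepresentable_fanoMatroid_of_two_eq_zero (K : Type) [Field K] (h : (2 : K) = 0) :
    IsRepresentable fanoMatroid K := by
  have : CharP K 2 := CharTwo.of_one_ne_zero_of_two_eq_zero one_ne_zero h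
  let : Algebra (ZMod 2) K := ZMod.algebra K 2
  let w (p : Projectivization (ZMod 2) (Fin 3 → ZMod 2)) : Fin 3 → K :=
    algebraMap (ZMod 2) K ∘ p.rep
  have hw : fanoMatroid = vectorMatroid K w :=
    -- Linear independence is unchanged under extension of scalars, so the Fano vectors also
    -- represent the matroid over `K`.
    Matroid.ext_indep rfl fun I _ => by
      rw [fanoMatroid, vectorMatroid_indep_iff, vectorMatroid_indep_iff]
      exact (linearIndependent_algebraMap_comp_iff
        (v := fun p : I => (p : Projectivization (ZMod 2) (Fin 3 → ZMod 2)).rep)).symm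
  rw [IsRepresentable, rank_fanoMatroid]
  refine ⟨⟨fun p => w p.1, fun X => ?_⟩⟩
  have hX := congrArg (fun M => M.eRk (Subtype.val '' X)) hw
  simp only [eRk_vectorMatroid] at hX
  rw [Set.image_image] at hX
  exact hX.symm

open Matrix in
/-- Vectors with the same dependencies as the points of the projective plane over the field with
two elements exist only in characteristic two. -/
theorem two_eq_zero_of_det_eq_zero_iff {K : Type} [Field K] (g : (Fin 3 → ZMod 2) → Fin 3 → K)
    (hg : ∀ c : Fin 3 → Fin 3 → ZMod 2, (∀ i, c i ≠ 0) →
      ((Matrix.of fun i => g (c i)).det = 0 ↔ (Matrix.of c).det = 0))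
    (h1 : ∀ i, g (Pi.single i 1) = Pi.single i 1) : (2 : K) = 0 := by
  have ha : g ![1, 0, 0] = ![1, 0, 0] := by
    convert h1 0 using 2 <;> ext i <;> fin_cases i <;> rfl
  have hb : g ![0, 1, 0] = ![0, 1, 0] := by
    convert h1 1 using 2 <;> ext i <;> fin_cases i <;> rfl
  have hc : g ![0, 0, 1] = ![0, 0, 1] := by
    convert h1 2 using 2 <;> ext i <;> fin_cases i <;> rfl
  have key : ∀ u v w : Fin 3 → ZMod 2, u ≠ 0 ∧ v ≠ 0 ∧ w ≠ 0 →
      ((Matrix.of ![g u, g v, g w]).det = 0 ↔ (Matrix.of ![u, v, w]).det = 0) := by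
    rintro u v w ⟨hu, hv, hw⟩
    rw [← hg ![u, v, w] (by intro i; fin_cases i <;> assumption)]
    have : (Matrix.of ![g u, g v, g w]) = Matrix.of fun i => g (![u, v, w] i) := by
      ext i j
      fin_cases i <;> rfl
    rw [this]
  have abd := (key ![1, 0, 0] ![0, 1, 0] ![1, 1, 0] (by decide)).2 (by decide)
  have ace := (key ![1, 0, 0] ![0, 0, 1] ![1, 0, 1] (by decide)).2 (by decide)
  have bch := (key ![0, 1, 0] ![0, 0, 1] ![0, 1, 1] (by decide)).2 (by decide)
  have cdo := (key ![0, 0, 1] ![1, 1, 0] ![1, 1, 1] (by decide)).2 (by decide)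
  have beo := (key ![0, 1, 0] ![1, 0, 1] ![1, 1, 1] (by decide)).2 (by decide)
  have aho := (key ![1, 0, 0] ![0, 1, 1] ![1, 1, 1] (by decide)).2 (by decide)
  have deh := (key ![1, 1, 0] ![1, 0, 1] ![0, 1, 1] (by decide)).2 (by decide)
  have hd1 := (key ![0, 1, 0] ![0, 0, 1] ![1, 1, 0] (by decide)).not.2 (by decide)
  have he3 := (key ![1, 0, 0] ![0, 1, 0] ![1, 0, 1] (by decide)).not.2 (by decide)
  have hh2 := (key ![1, 0, 0] ![0, 0, 1] ![0, 1, 1] (by decide)).not.2 (by decide)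
  have ho1 := (key ![0, 1, 0] ![0, 0, 1] ![1, 1, 1] (by decide)).not.2 (by decide)
  have ho2 := (key ![1, 0, 0] ![0, 0, 1] ![1, 1, 1] (by decide)).not.2 (by decide)
  have ho3 := (key ![1, 0, 0] ![0, 1, 0] ![1, 1, 1] (by decide)).not.2 (by decide)
  rw [det_fin_three] at *
  simp [ha, hb, hc] at abd ace bch cdo beo aho deh hd1 he3 hh2 ho1 ho2 ho3
  generalize g ![1, 1, 0] = d at *
  generalize g ![1, 0, 1] = e at *
  generalize g ![0, 1, 1] = h at *
  generalize g ![1, 1, 1] = o at *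
  rw [abd, ace, bch] at deh
  -- Collinearity of `d`, `e`, `h` says `d 0 * e 2 * h 1 + d 1 * e 0 * h 2 = 0`. The lines through
  -- `o` make the two terms equal after multiplication by the coordinates of `o`.
  have h0 : 2 * (d 0 * e 2 * h 1 * (o 0 * o 1 * o 2)) = 0 := by
    linear_combination (-(o 0 * o 1 * o 2)) * deh + (e 2 * o 0 * h 1 * o 2) * cdo +
      (d 1 * o 0 * h 1 * o 2) * beo + (d 1 * o 0 * e 0 * o 2) * aho
  simpa [hd1, he3, hh2, ho1, ho2, ho3] using h0

theorem two_eq_zero_of_isRepresentable_fanoMatroid (K : Type) [Field K]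
    (h : IsRepresentable fanoMatroid K) : (2 : K) = 0 := by
  classical
  rw [IsRepresentable, rank_fanoMatroid] at h
  obtain ⟨f, hf⟩ := h
  let g (u : Fin 3 → ZMod 2) : Fin 3 → K :=
    if hu : u ≠ 0 then f ⟨Projectivization.mk (ZMod 2) u hu, trivial⟩ else 0
  have hrep : ∀ (u : Fin 3 → ZMod 2) (hu : u ≠ 0), (Projectivization.mk (ZMod 2) u hu).rep = u := by
    intro u hu
    obtain ⟨a, ha⟩ := Projectivization.exists_smul_eq_mk_rep (ZMod 2) u hu
    rw [← ha, Subsingleton.elim a 1, one_smul]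
  have hdet : ∀ c : Fin 3 → Fin 3 → ZMod 2, (∀ i, c i ≠ 0) →
      ((Matrix.of fun i => g (c i)).det = 0 ↔ (Matrix.of c).det = 0) := by
    intro c hc
    have hrank := hf (Set.range fun i => ⟨Projectivization.mk (ZMod 2) (c i) (hc i), trivial⟩)
    rw [eRk_fanoMatroid, ← Set.range_comp, ← Set.range_comp, ← Set.range_comp,
      Nat.cast_inj] at hrank
    have e1 : (f ∘ fun i => ⟨Projectivization.mk (ZMod 2) (c i) (hc i), trivial⟩) =
        fun i => g (c i) := by
      ext i
      simp [g, hc i]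
    have e2 : (Projectivization.rep ∘ Subtype.val ∘ fun i =>
        (⟨Projectivization.mk (ZMod 2) (c i) (hc i), trivial⟩ : fanoMatroid.E)) = c := by
      ext i
      simp [hrep]
    have e3 : LinearIndependent K (fun i => g (c i)) ↔ LinearIndependent (ZMod 2) c := by
      rw [linearIndependent_iff_card_eq_finrank_span, linearIndependent_iff_card_eq_finrank_span,
        Set.finrank, Set.finrank, ← e1]
      conv_rhs => rw [← e2]
      exact Eq.congr_right hrank
    have h1 := Matrix.linearIndependent_rows_iff_isUnit (A := Matrix.of fun i => g (c i))
    have h2 := Matrix.linearIndependent_rows_iff_isUnit (A := Matrix.of c)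
    rw [Matrix.isUnit_iff_isUnit_det, isUnit_iff_ne_zero] at h1 h2
    exact not_iff_not.1 (h1.symm.trans (e3.trans h2))
  -- The images of the standard basis are independent; `M⁻¹` moves them back to the standard basis.
  let M : Matrix (Fin 3) (Fin 3) K := Matrix.of fun i => g (Pi.single i 1)
  have hM : M.det ≠ 0 := by
    rw [Ne, hdet (fun i => Pi.single i 1) (by decide)]
    decide
  have hMu : IsUnit M.det := isUnit_iff_ne_zero.2 hM
  refine two_eq_zero_of_det_eq_zero_iff (fun u => Matrix.vecMul (g u) M⁻¹) (fun c hc => ?_)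
    fun i => ?_
  · have : (Matrix.of fun i => Matrix.vecMul (g (c i)) M⁻¹) =
        (Matrix.of fun i => g (c i)) * M⁻¹ := by
      ext i j
      rfl
    rw [this, Matrix.det_mul, ← hdet c hc, mul_eq_zero, or_iff_left]
    exact ((Matrix.isUnit_nonsing_inv_det_iff).2 hMu).ne_zero
  · have : Matrix.vecMul (g (Pi.single i 1)) M⁻¹ = (M * M⁻¹) i := rfl
    rw [this, Matrix.mul_nonsing_inv _ hMu]
    ext j
    simp [Matrix.one_apply, Pi.single_apply, eq_comm]

theorem isRepresentable_fanoMatroid_iff (K : Type) [Field K] [Finite K] :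
    IsRepresentable fanoMatroid K ↔ 2 ∣ Nat.card K := by
  rw [two_dvd_card_iff]
  exact ⟨two_eq_zero_of_isRepresentable_fanoMatroid K, isRepresentable_fanoMatroid_of_two_eq_zero K⟩

theorem countRepresentations_ne_zero_iff {α : Type} [Finite α] (M : Matroid α) (K : Type) [Field K]
    [Finite K] : countRepresentations M K ≠ 0 ↔ IsRepresentable M K := by
  have : Finite (Representation M (rank M) K) := by
    unfold Representation
    infer_instance
  rw [countRepresentations, IsRepresentable, Ne, Finite.card_eq_zero_iff, not_isEmpty_iff]

/-- The powers of 3 force `a = 0`; the powers of 2, where the count is positive, then force `b = 0`.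
-/
theorem not_isRational_countRepresentations_fanoMatroid :
    ¬ IsRational (countRepresentations fanoMatroid) := by
  rintro ⟨a, b, hb, h⟩
  have hcard : ∀ p n : ℕ, [Fact p.Prime] → n ≠ 0 → Finite (GaloisField p n) ∧
      Nat.card (GaloisField p n) = p ^ n := by
    intro p n hp hn
    have hc := GaloisField.card p n hn
    refine ⟨Nat.finite_of_card_ne_zero ?_, hc⟩
    rw [hc]
    exact pow_ne_zero _ hp.out.ne_zero
  have ha : a = 0 := by
    refine eq_zero_of_eval_prime_pow 3 Nat.prime_three fun n hn => ?_
    have : Fact (Nat.Prime 3) := ⟨Nat.prime_three⟩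
    obtain ⟨_, hc⟩ := hcard 3 n hn
    rw [← hc, ← h]
    have h0 : countRepresentations fanoMatroid (GaloisField 3 n) = 0 := by
      by_contra h0
      rw [← Ne, countRepresentations_ne_zero_iff, isRepresentable_fanoMatroid_iff, hc] at h0
      have := Nat.prime_two.dvd_of_dvd_pow h0
      omega
    rw [h0, Nat.cast_zero, mul_zero]
  refine hb (eq_zero_of_eval_prime_pow 2 Nat.prime_two fun n hn => ?_)
  obtain ⟨_, hc⟩ := hcard 2 n hn
  have hK := h (GaloisField 2 n)
  rw [ha, eval_zero, mul_eq_zero, hc] at hK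
  refine hK.resolve_right (Nat.cast_ne_zero.2 ?_)
  rw [countRepresentations_ne_zero_iff, isRepresentable_fanoMatroid_iff, hc]
  exact dvd_pow_self 2 hn

end PointCount

end

/-- The conjectures of Stembridge, Stanley and Kontsevich are false, even if polynomials with
rational coefficients are allowed. The Fano matroid has rank `3`, it is representable over the
finite field with `q` elements if and only if `2 ∣ q`, and the number of its representations is not
a rational function of `q`. -/
theorem mainTheorem4 :
    ¬ PointCount.StembridgeConjecture ℚ ∧
    ¬ PointCount.StanleyConjecture ℚ ∧
    ¬ PointCount.KontsevichConjecture ℚ ∧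
    PointCount.fanoMatroid.eRank = 3 ∧
    (∀ (K : Type) [Field K] [Finite K],
      PointCount.IsRepresentable PointCount.fanoMatroid K ↔ 2 ∣ Nat.card K) ∧
    ¬ PointCount.IsRational (PointCount.countRepresentations PointCount.fanoMatroid) := by
  exact ⟨PointCount.not_stembridgeConjecture, PointCount.not_stanleyConjecture,
    PointCount.not_kontsevichConjecture, PointCount.eRank_fanoMatroid,
    PointCount.isRepresentable_fanoMatroid_iff,
    PointCount.not_isRational_countRepresentations_fanoMatroid⟩
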